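/- Let $p$ be a natural number and let $(\varepsilon_t)_{t\in\mathbb Z}$ be i.i.d. real random variables on a probability space $(\Omega,\mathcal F,P)$ with $E\varepsilon_1=0$, $E\varepsilon_1^2<\infty$, whose law has a Lebesgue density $g$. Assume that $g$ is differentiable and $$g(x)>0\ \ (x\in\mathbb R),\qquad \lim_{|x|\to\infty}x\,g(x)=0,\qquad \sup_x(1+x^2)|g'(x)|<\infty,\qquad \int_{\mathbb R}|x\,g'(x)|\,dx<\infty .$$ Let $0<\beta\le E\varepsilon_1^2$ and $\Theta=\{a\in\mathbb R^p: a_1,\dots,a_p\ge 0,\ \|a\|_1\le\beta^{-1}\}$, where $\|a\|_1=\sum_i|a_i|$. Let $b\in\Theta$ and $\delta>0$ satisfy $E\varepsilon_1^2\,(\|b\|_1+\delta)<1$, and put $\Theta^\delta=\{a\in\Theta:\|a-b\|_1\le\delta\}$ (so $E\varepsilon_1^2\,(a_1+\dots+a_p)<1$ for all $a\in\Theta^\delta$). For $a\in\Theta^\delta$ let $(y^a_t)_{t\in\mathbb Z}$ be a strictly stationary process on $(\Omega,\mathcal F,P)$ that solves the ARCH($p$) equation, that is, for every $t\in\mathbb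 Z$, almost surely $$y^a_t=\sigma_t\,\varepsilon_t,\qquad \sigma_t=\bigl(1+a_1(y^a_{t-1})^2+\dots+a_p(y^a_{t-p})^2\bigr)^{1/2},$$ and put $Y^a_t=(y^a_t,\dots,y^a_{t-p+1})$. For $\sigma$-algebras $\mathcal A,\mathcal B\subseteq\mathcal F$ let $\alpha(\mathcal A,\mathcal B)=\sup\{|P(A\cap B)-P(A)P(B)|:A\in\mathcal A,\ B\in\mathcal B\}$ be the strong mixing coefficient. Then there are constants $C<\infty$ and $\gamma>0$, not depending on $a$ or $t$, such that for all $a\in\Theta^\delta$ and all $t\in\mathbb Z$ $$\alpha\bigl(\sigma\{Y^a_{t-1}\},\ \sigma\{y^a_s,\ s\le 0\}\bigr)\le C\,e^{-\gamma t}.$$ -/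

import Mathlib

open MeasureTheory ProbabilityTheory Filter Topology

noncomputable section

namespace ARCH

/-- The `ℓ¹` norm on `ℝᵖ`. -/
def l1Norm {p : ℕ} (a : Fin p → ℝ) : ℝ := ∑ i, |a i|

/-- The parameter set `Θ`: nonnegative coordinates and `ℓ¹` norm at most `β⁻¹`. -/
def Theta (p : ℕ) (β : ℝ) : Set (Fin p → ℝ) :=
  {a | (∀ i, 0 ≤ a i) ∧ l1Norm a ≤ β⁻¹}

/-- `Θ^δ`: the part of `Θ` in the closed `ℓ¹` ball of radius `δ` about `b`. -/
def ThetaDelta (p : ℕ) (β : ℝ) (b : Fin p → ℝ) (δ : ℝ) : Set (Fin p → ℝ) :=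
  {a | l1Norm (fun i => a i - b i) ≤ δ} ∩ Theta p β

/-- The regularity conditions on the innovation density: `g` is positive and differentiable,
`x g(x) → 0` as `|x| → ∞`, `sup (1 + x²)|g'(x)| < ∞` and `∫ |x g'(x)| dx < ∞`. -/
structure RegularDensity (g : ℝ → ℝ) : Prop where
  pos : ∀ x, 0 < g x
  differentiable : Differentiable ℝ g
  tendsto_mul : Tendsto (fun x => x * g x) (cocompact ℝ) (𝓝 0)
  deriv_bdd : BddAbove (Set.range fun x => (1 + x ^ 2) * |deriv g x|)
  integrable_deriv : Integrable (fun x => deriv g x * x)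

variable {Ω : Type*} [MeasurableSpace Ω]

/-- `(ε_t)` is a sequence of i.i.d. random variables whose law has Lebesgue density `g`. -/
structure IIDWithDensity (P : Measure Ω) (ε : ℤ → Ω → ℝ) (g : ℝ → ℝ) : Prop where
  measurable : ∀ t, Measurable (ε t)
  indep : iIndepFun ε P
  law : ∀ t, P.map (ε t) = volume.withDensity (fun x => ENNReal.ofReal (g x))

/-- Strict stationarity: the law of the process on `ℝ^ℤ` is invariant under all time shifts. -/
def StrictlyStationary (P : Measure Ω) (y : ℤ → Ω → ℝ) : Prop :=
  ∀ h : ℤ, P.map (fun ω (t : ℤ) => y (t + h) ω) = P.map (fun ω (t : ℤ) => y t ω)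

/-- The lag vector `Y_t = (y_t, …, y_{t-p+1})`. -/
def lagVector (p : ℕ) (y : ℤ → Ω → ℝ) (t : ℤ) (ω : Ω) : Fin p → ℝ :=
  fun j => y (t - (j : ℕ)) ω

/-- `y` is a strictly stationary solution of the ARCH(`p`) equation
`y_t = σ_t ε_t`, `σ_t² = 1 + a₁ y_{t-1}² + … + a_p y_{t-p}²`, `t ∈ ℤ`
(`a j` with `j : Fin p` stands for the coefficient of `y_{t-1-j}²`). -/
structure IsStationarySolution {p : ℕ} (P : Measure Ω) (ε : ℤ → Ω → ℝ) (a : Fin p → ℝ)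
    (y : ℤ → Ω → ℝ) : Prop where
  measurable : ∀ t, Measurable (y t)
  stationary : StrictlyStationary P y
  equation : ∀ t, ∀ᵐ ω ∂P,
    y t ω = √(1 + ∑ j, a j * lagVector p y (t - 1) ω j ^ 2) * ε t ω

/-- The strong mixing coefficient
`α(𝒜, ℬ) = sup {|P(A ∩ B) - P(A) P(B)| : A ∈ 𝒜, B ∈ ℬ}` (a supremum of numbers in `[0, 1]`
when `P` is a probability measure). -/
def strongMixingCoeff (P : Measure Ω) (𝒜 ℬ : MeasurableSpace Ω) : ℝ :=
  sSup {r | ∃ A B : Set Ω, MeasurableSet[𝒜] A ∧ MeasurableSet[ℬ] B ∧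
    r = |P.real (A ∩ B) - P.real A * P.real B|}

/-- `σ{Y_t}`. -/
def sigmaLag (p : ℕ) (y : ℤ → Ω → ℝ) (t : ℤ) : MeasurableSpace Ω :=
  MeasurableSpace.comap (lagVector p y t) inferInstance

/-- `σ{y_s, s ≤ 0}`. -/
def sigmaPast (y : ℤ → Ω → ℝ) : MeasurableSpace Ω :=
  ⨆ s : {s : ℤ // s ≤ 0}, MeasurableSpace.comap (y s) inferInstance

end ARCH

end

/-!
Write `m` for the second moment of the innovations and `s` for the sum of the coefficients, so that
`s * m < 1`. Squared ARCH states satisfy a random affine recursion with nonnegative coefficients,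
and the difference of two squared states driven by the same innovations is dominated by its
homogeneous version, whose mean decays like `θ ^ n` for any `θ < 1` with `s * m ≤ θ ^ p`. Started
in `0` ever further in the past, the recursion therefore converges to the stationary solution, which
is thus a function of past innovations and has second moments at most `m / (1 - s * m)`.

Since the innovations have a density whose scale family is Lipschitz in `L¹`, each application of
the transition operator makes a bounded function Lipschitz in one more squared coordinate, so `p`
applications make it Lipschitz in the whole squared state. Hence, up to an error of order `θ ^ n`,
the event `Y_{n+p} ∈ A` may be replaced by the same event for the state started in `0` at time `0`,
and the latter is independent of everything up to time `0`.
-/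

noncomputable section

namespace ARCH

section ScaleFamily

variable {g : ℝ → ℝ}

/-- The density of `s * X` when `X` has density `g` and `0 < s`. -/
def scaledDensity (g : ℝ → ℝ) (s z : ℝ) : ℝ := s⁻¹ * g (s⁻¹ * z)

/-- The `L¹` norm of `(x g(x))'`, which is the `L¹` speed of the scale family of `g` when the scale
is parametrised by its logarithm. -/
def scaleSpeed (g : ℝ → ℝ) : ℝ := ∫ x, |g x + deriv g x * x|

theorem scaleSpeed_nonneg (g : ℝ → ℝ) : 0 ≤ scaleSpeed g :=
  integral_nonneg fun _ => abs_nonneg _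

theorem integrable_scaledDensity (hgi : Integrable g) {s : ℝ} (hs : 0 < s) :
    Integrable (scaledDensity g s) :=
  (hgi.comp_mul_left' (inv_pos.2 hs).ne').const_mul _

theorem integral_scaledDensity (g : ℝ → ℝ) {s : ℝ} (hs : 0 < s) :
    ∫ z, scaledDensity g s z = ∫ z, g z := by
  simp only [scaledDensity]
  rw [integral_const_mul, Measure.integral_comp_mul_left, inv_inv, abs_of_pos hs, smul_eq_mul,
    inv_mul_cancel_left₀ hs.ne']

theorem hasDerivAt_mul_comp_mul (hg : Differentiable ℝ g) (z w : ℝ) :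
    HasDerivAt (fun w => w * g (w * z)) (g (w * z) + deriv g (w * z) * (w * z)) w := by
  have hcomp : HasDerivAt (fun w => g (w * z)) (deriv g (w * z) * z) w :=
    (hg (w * z)).hasDerivAt.comp w (hasDerivAt_mul_const z)
  exact ((hasDerivAt_id' w).mul hcomp).congr_deriv (by ring)

theorem intervalIntegrable_comp_mul_right {k : ℝ → ℝ} (hk : Integrable k) (z u v : ℝ) :
    IntervalIntegrable (fun w => k (w * z)) volume u v := by
  rcases eq_or_ne z 0 with rfl | hz
  · simp
  · exact (hk.comp_mul_right' hz).intervalIntegrable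

theorem enorm_mul_comp_mul_sub_le (hg : Differentiable ℝ g) (hgi : Integrable g)
    (hg' : Integrable fun x => deriv g x * x) {u v : ℝ} (huv : u ≤ v) (z : ℝ) :
    ‖u * g (u * z) - v * g (v * z)‖ₑ ≤
      ∫⁻ w in Set.Ioc u v, ‖g (w * z) + deriv g (w * z) * (w * z)‖ₑ := by
  rw [← enorm_neg, neg_sub, ← intervalIntegral.integral_eq_sub_of_hasDerivAt
    (fun w _ => hasDerivAt_mul_comp_mul hg z w)
    (intervalIntegrable_comp_mul_right (hgi.add hg') z u v), intervalIntegral.integral_of_le huv]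
  exact enorm_integral_le_lintegral_enorm _

theorem lintegral_enorm_comp_mul_left {k : ℝ → ℝ} (hk : Integrable k) {w : ℝ} (hw : 0 < w) :
    ∫⁻ z, ‖k (w * z)‖ₑ = ENNReal.ofReal (w⁻¹ * ∫ x, |k x|) := by
  rw [← ofReal_integral_norm_eq_lintegral_enorm (hk.comp_mul_left' hw.ne')]
  simp only [Real.norm_eq_abs]
  rw [Measure.integral_comp_mul_left (fun x => |k x|), abs_of_pos (inv_pos.2 hw), smul_eq_mul]

theorem setLIntegral_Ioc_inv_mul {u v c : ℝ} (hu : 0 < u) (huv : u ≤ v) (hc : 0 ≤ c) :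
    ∫⁻ w in Set.Ioc u v, ENNReal.ofReal (w⁻¹ * c) = ENNReal.ofReal (c * Real.log (v / u)) := by
  have hint : IntervalIntegrable (fun w : ℝ => w⁻¹ * c) volume u v := by
    refine (intervalIntegral.intervalIntegrable_inv (fun w hw => ?_) continuousOn_id).mul_const c
    rw [Set.uIcc_of_le huv] at hw
    exact (hu.trans_le hw.1).ne'
  rw [← ofReal_integral_eq_lintegral_ofReal
    ((intervalIntegrable_iff_integrableOn_Ioc_of_le huv).1 hint),
    ← intervalIntegral.integral_of_le huv, intervalIntegral.integral_mul_const,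
    integral_inv_of_pos hu (hu.trans_le huv), mul_comm]
  filter_upwards [ae_restrict_mem measurableSet_Ioc] with w hw
  exact mul_nonneg (inv_nonneg.2 (hu.trans hw.1).le) hc

theorem integral_abs_mul_comp_mul_sub_le (hg : Differentiable ℝ g) (hgi : Integrable g)
    (hg' : Integrable fun x => deriv g x * x) {u v : ℝ} (hu : 0 < u) (huv : u ≤ v) :
    ∫ z, |u * g (u * z) - v * g (v * z)| ≤ scaleSpeed g * Real.log (v / u) := by
  have hlog : 0 ≤ Real.log (v / u) := Real.log_nonneg ((one_le_div hu).2 huv)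
  have hcont := hg.continuous
  have hk : Measurable fun x => g x + deriv g x * x :=
    hcont.measurable.add ((measurable_deriv g).mul measurable_id)
  have hbound : ∫⁻ z, ‖u * g (u * z) - v * g (v * z)‖ₑ ≤
      ENNReal.ofReal (scaleSpeed g * Real.log (v / u)) :=
    calc ∫⁻ z, ‖u * g (u * z) - v * g (v * z)‖ₑ
        ≤ ∫⁻ z, ∫⁻ w in Set.Ioc u v, ‖g (w * z) + deriv g (w * z) * (w * z)‖ₑ :=
          lintegral_mono fun z => enorm_mul_comp_mul_sub_le hg hgi hg' huv z
      _ = ∫⁻ w in Set.Ioc u v, ∫⁻ z, ‖g (w * z) + deriv g (w * z) * (w * z)‖ₑ :=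
          lintegral_lintegral_swap
            (hk.comp (measurable_snd.mul measurable_fst)).enorm.aemeasurable
      _ = ∫⁻ w in Set.Ioc u v, ENNReal.ofReal (w⁻¹ * scaleSpeed g) :=
          setLIntegral_congr_fun measurableSet_Ioc fun w hw =>
            lintegral_enorm_comp_mul_left (hgi.add hg') (hu.trans hw.1)
      _ = ENNReal.ofReal (scaleSpeed g * Real.log (v / u)) :=
          setLIntegral_Ioc_inv_mul hu huv (scaleSpeed_nonneg g)
  have hmeas : AEStronglyMeasurable fun z => u * g (u * z) - v * g (v * z) :=
    Continuous.aestronglyMeasurable (by fun_prop)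
  simp only [← Real.norm_eq_abs]
  rw [integral_norm_eq_lintegral_enorm hmeas]
  exact ENNReal.toReal_le_of_le_ofReal (mul_nonneg (scaleSpeed_nonneg g) hlog) hbound

theorem log_div_le_abs_sq_sub_sq {r s : ℝ} (hr : 1 ≤ r) (hrs : r ≤ s) :
    Real.log (s / r) ≤ |s ^ 2 - r ^ 2| := by
  have hr0 : 0 < r := zero_lt_one.trans_le hr
  calc Real.log (s / r) ≤ s / r - 1 := Real.log_le_sub_one_of_pos (div_pos (hr0.trans_le hrs) hr0)
    _ ≤ s - r := by
      rw [div_sub_one hr0.ne']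
      exact div_le_self (sub_nonneg.2 hrs) hr
    _ ≤ (s - r) * (s + r) := le_mul_of_one_le_right (sub_nonneg.2 hrs) (by linarith)
    _ ≤ |s ^ 2 - r ^ 2| := by
      rw [mul_comm, ← sq_sub_sq]
      exact le_abs_self _

theorem integral_abs_scaledDensity_sub_le (hg : Differentiable ℝ g) (hgi : Integrable g)
    (hg' : Integrable fun x => deriv g x * x) {s r : ℝ} (hs : 1 ≤ s) (hr : 1 ≤ r) :
    ∫ z, |scaledDensity g s z - scaledDensity g r z| ≤ scaleSpeed g * |s ^ 2 - r ^ 2| := by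
  wlog hrs : r ≤ s generalizing s r
  · simp only [abs_sub_comm (scaledDensity g s _), abs_sub_comm (s ^ 2)]
    exact this hr hs (le_of_not_ge hrs)
  have hr0 : 0 < r := zero_lt_one.trans_le hr
  refine (integral_abs_mul_comp_mul_sub_le hg hgi hg' (inv_pos.2 (hr0.trans_le hrs))
    (inv_anti₀ hr0 hrs)).trans ?_
  rw [inv_div_inv]
  exact mul_le_mul_of_nonneg_left (log_div_le_abs_sq_sub_sq hr hrs) (scaleSpeed_nonneg g)

end ScaleFamily

section RandomRecursion

variable {ι Ω E F : Type*}

/-- The state at time `s + n` of the recursion `X_t = f(X_{t-1}, ξ_t)` started in `x` at time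
`s`. -/
def trajectory (f : E → F → E) (x : E) (ξ : ℤ → Ω → F) (s : ℤ) : ℕ → Ω → E
  | 0, _ => x
  | n + 1, ω => f (trajectory f x ξ s n ω) (ξ (s + n + 1) ω)

theorem abs_indicator_one_le (A : Set E) (x : E) : |A.indicator (1 : E → ℝ) x| ≤ 1 := by
  by_cases hx : x ∈ A <;> simp [hx]

variable [MeasurableSpace F]

/-- The transition operator `ψ ↦ E ψ(f(x, ξ))` of the recursion `f` driven by noise with law
`ν`. -/
def transitionOp (ν : Measure F) (f : E → F → E) (ψ : E → ℝ) (x : E) : ℝ := ∫ e, ψ (f x e) ∂ν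

theorem abs_transitionOp_iterate_le (ν : Measure F) [IsProbabilityMeasure ν] (f : E → F → E)
    {ψ : E → ℝ} {c : ℝ} (hψ : ∀ x, |ψ x| ≤ c) (n : ℕ) (x : E) :
    |(transitionOp ν f)^[n] ψ x| ≤ c := by
  induction n generalizing x with
  | zero => exact hψ x
  | succ n ih =>
    rw [Function.iterate_succ_apply']
    simpa [transitionOp] using
      norm_integral_le_of_norm_le_const (μ := ν)
        (f := fun e => (transitionOp ν f)^[n] ψ (f x e)) (C := c) (ae_of_all _ fun e => ih (f x e))

/-- The σ-algebra generated by the `ξ i` with `i ∈ I`. -/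
abbrev sigmaOn (ξ : ι → Ω → F) (I : Set ι) : MeasurableSpace Ω :=
  ⨆ i ∈ I, MeasurableSpace.comap (ξ i) inferInstance

theorem sigmaOn_mono (ξ : ι → Ω → F) {I J : Set ι} (h : I ⊆ J) : sigmaOn ξ I ≤ sigmaOn ξ J :=
  biSup_mono h

theorem measurable_sigmaOn (ξ : ι → Ω → F) {I : Set ι} {i : ι} (hi : i ∈ I) :
    Measurable[sigmaOn ξ I] (ξ i) :=
  (comap_measurable (ξ i)).mono
    (le_biSup (fun i => MeasurableSpace.comap (ξ i) inferInstance) hi) le_rfl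

variable [MeasurableSpace E]

theorem measurable_trajectory {f : E → F → E} (hf : Measurable fun q : E × F => f q.1 q.2) (x : E)
    (ξ : ℤ → Ω → F) (s : ℤ) (n : ℕ) :
    Measurable[sigmaOn ξ (Set.Ioc s (s + n))] (trajectory f x ξ s n) := by
  induction n with
  | zero => exact measurable_const
  | succ n ih =>
    have hstate : Measurable[sigmaOn ξ (Set.Ioc s (s + (n + 1 : ℕ)))] (trajectory f x ξ s n) :=
      ih.mono (sigmaOn_mono ξ (Set.Ioc_subset_Ioc_right (by push_cast; omega))) le_rfl
    have hnoise : Measurable[sigmaOn ξ (Set.Ioc s (s + (n + 1 : ℕ)))] (ξ (s + n + 1)) :=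
      measurable_sigmaOn ξ ⟨by omega, by push_cast; omega⟩
    exact hf.comp (hstate.prodMk hnoise)

theorem measurable_transitionOp_iterate (ν : Measure F) [SFinite ν] {f : E → F → E}
    (hf : Measurable fun q : E × F => f q.1 q.2) {ψ : E → ℝ} (hψ : Measurable ψ) (n : ℕ) :
    Measurable ((transitionOp ν f)^[n] ψ) := by
  induction n with
  | zero => exact hψ
  | succ n ih =>
    rw [Function.iterate_succ_apply']
    exact (ih.comp hf).stronglyMeasurable.integral_prod_right'.measurable

variable [MeasurableSpace Ω] {P : Measure Ω}

/-- `(ξ i)` is an i.i.d. family with common law `ν`. -/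
structure IIDWithLaw (P : Measure Ω) (ξ : ι → Ω → F) (ν : Measure F) : Prop where
  measurable : ∀ i, Measurable (ξ i)
  indep : iIndepFun ξ P
  law : ∀ i, P.map (ξ i) = ν

namespace IIDWithLaw

variable {ξ : ι → Ω → F} {ν : Measure F}

theorem sigmaOn_le (h : IIDWithLaw P ξ ν) (I : Set ι) : sigmaOn ξ I ≤ ‹MeasurableSpace Ω› :=
  iSup₂_le fun i _ => (h.measurable i).comap_le

theorem indep_sigmaOn (h : IIDWithLaw P ξ ν) {I J : Set ι} (hIJ : Disjoint I J) :
    Indep (sigmaOn ξ I) (sigmaOn ξ J) P :=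
  indep_iSup_of_disjoint (fun i => (h.measurable i).comap_le) h.indep hIJ

theorem indepFun (h : IIDWithLaw P ξ ν) {I J : Set ι} (hIJ : Disjoint I J) {X : Ω → E}
    {G : Type*} [MeasurableSpace G] {Y : Ω → G} (hX : Measurable[sigmaOn ξ I] X)
    (hY : Measurable[sigmaOn ξ J] Y) : IndepFun X Y P :=
  indep_of_indep_of_le_left (indep_of_indep_of_le_right (h.indep_sigmaOn hIJ) hY.comap_le)
    hX.comap_le

theorem indepFun_of_notMem (h : IIDWithLaw P ξ ν) {I : Set ι} {i : ι} (hi : i ∉ I) {X : Ω → E}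
    (hX : Measurable[sigmaOn ξ I] X) : IndepFun X (ξ i) P :=
  h.indepFun (Set.disjoint_singleton_right.2 hi) hX
    (measurable_sigmaOn ξ (Set.mem_singleton i))

theorem isProbabilityMeasure_law [IsProbabilityMeasure P] [Nonempty ι] (h : IIDWithLaw P ξ ν) :
    IsProbabilityMeasure ν := by
  rw [← h.law (Classical.arbitrary ι)]
  exact Measure.isProbabilityMeasure_map (h.measurable _).aemeasurable

end IIDWithLaw

theorem integral_comp_prodMk_of_indepFun [IsProbabilityMeasure P] {U : Ω → E} {V : Ω → F}
    (hU : Measurable U) (hV : Measurable V) (hUV : IndepFun U V P) {φ : E × F → ℝ}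
    (hφ : Measurable φ) (hi : Integrable (fun ω => φ (U ω, V ω)) P) :
    ∫ ω, φ (U ω, V ω) ∂P = ∫ ω, ∫ v, φ (U ω, v) ∂(P.map V) ∂P := by
  have := Measure.isProbabilityMeasure_map (μ := P) hV.aemeasurable
  have hlaw := hUV.map_prod_eq_prod_map_map hU.aemeasurable hV.aemeasurable
  have hφi : Integrable φ ((P.map U).prod (P.map V)) := by
    rw [← hlaw]
    exact (integrable_map_measure hφ.aestronglyMeasurable (hU.prodMk hV).aemeasurable).2 hi
  rw [← integral_map (hU.prodMk hV).aemeasurable hφ.aestronglyMeasurable, hlaw,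
    integral_prod _ hφi, integral_map hU.aemeasurable]
  exact hφ.stronglyMeasurable.integral_prod_right'.aestronglyMeasurable

namespace IIDWithLaw

theorem integral_mul_comp_step [IsProbabilityMeasure P] {ξ : ι → Ω → F} {ν : Measure F}
    (h : IIDWithLaw P ξ ν) {f : E → F → E} (hf : Measurable fun q : E × F => f q.1 q.2)
    {I : Set ι} {i : ι} (hi : i ∉ I) {X : Ω → E} (hX : Measurable[sigmaOn ξ I] X)
    {H : Ω → ℝ} (hH : Measurable[sigmaOn ξ I] H) (hHi : Integrable H P)
    {ψ : E → ℝ} (hψ : Measurable ψ) {c : ℝ} (hψc : ∀ x, |ψ x| ≤ c) :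
    ∫ ω, H ω * ψ (f (X ω) (ξ i ω)) ∂P = ∫ ω, H ω * transitionOp ν f ψ (X ω) ∂P := by
  have hle := h.sigmaOn_le I
  have hHX : Measurable[sigmaOn ξ I] fun ω => (H ω, X ω) := hH.prodMk hX
  have hφ : Measurable fun q : (ℝ × E) × F => q.1.1 * ψ (f q.1.2 q.2) :=
    (measurable_fst.comp measurable_fst).mul
      (hψ.comp (hf.comp ((measurable_snd.comp measurable_fst).prodMk measurable_snd)))
  have hint : Integrable (fun ω => H ω * ψ (f (X ω) (ξ i ω))) P :=
    hHi.mul_bdd (c := c)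
      (hψ.comp (hf.comp ((hX.mono hle le_rfl).prodMk (h.measurable i)))).aestronglyMeasurable
      (ae_of_all _ fun ω => hψc _)
  rw [integral_comp_prodMk_of_indepFun (hHX.mono hle le_rfl) (h.measurable i)
    (h.indepFun_of_notMem hi hHX) hφ hint, h.law i]
  simp only [integral_const_mul, transitionOp]

variable {ξ : ℤ → Ω → F} {ν : Measure F}

theorem integral_mul_transitionOp_iterate [IsProbabilityMeasure P] (h : IIDWithLaw P ξ ν)
    {f : E → F → E} (hf : Measurable fun q : E × F => f q.1 q.2) {X : ℕ → Ω → E}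
    (hX : ∀ n : ℕ, Measurable[sigmaOn ξ (Set.Iic (n : ℤ))] (X n))
    (hrec : ∀ n : ℕ, ∀ᵐ ω ∂P, X (n + 1) ω = f (X n ω) (ξ (n + 1) ω))
    {H : Ω → ℝ} (hH : Measurable[sigmaOn ξ (Set.Iic 0)] H) (hHi : Integrable H P)
    {ψ : E → ℝ} (hψ : Measurable ψ) {c : ℝ} (hψc : ∀ x, |ψ x| ≤ c) (n k : ℕ) :
    ∫ ω, H ω * ψ (X (n + k) ω) ∂P = ∫ ω, H ω * (transitionOp ν f)^[k] ψ (X n ω) ∂P := by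
  have hν := h.isProbabilityMeasure_law
  induction k generalizing ψ with
  | zero => rfl
  | succ k ih =>
    have hT := measurable_transitionOp_iterate ν hf hψ 1
    have hHk : Measurable[sigmaOn ξ (Set.Iic ((n + k : ℕ) : ℤ))] H :=
      hH.mono (sigmaOn_mono ξ (Set.Iic_subset_Iic.2 (Int.natCast_nonneg _))) le_rfl
    calc ∫ ω, H ω * ψ (X (n + (k + 1)) ω) ∂P
        = ∫ ω, H ω * ψ (f (X (n + k) ω) (ξ ((n + k : ℕ) + 1) ω)) ∂P :=
          integral_congr_ae ((hrec (n + k)).mono fun ω hω => by simp only [← hω, ← add_assoc])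
      _ = ∫ ω, H ω * transitionOp ν f ψ (X (n + k) ω) ∂P :=
          h.integral_mul_comp_step hf (by simp) (hX _) hHk hHi hψ hψc
      _ = ∫ ω, H ω * (transitionOp ν f)^[k + 1] ψ (X n ω) ∂P :=
          ih hT (abs_transitionOp_iterate_le ν f hψc 1)

end IIDWithLaw

theorem abs_measureReal_inter_sub_mul_le [IsProbabilityMeasure P] {A B : Set Ω} {q c : ℝ}
    (hAB : |P.real (A ∩ B) - q * P.real B| ≤ c) (hA : |P.real A - q| ≤ c) :
    |P.real (A ∩ B) - P.real A * P.real B| ≤ 2 * c := by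
  calc |P.real (A ∩ B) - P.real A * P.real B|
      = |(P.real (A ∩ B) - q * P.real B) - (P.real A - q) * P.real B| := by ring_nf
    _ ≤ |P.real (A ∩ B) - q * P.real B| + |P.real A - q| * P.real B := by
        simpa only [abs_mul, abs_of_nonneg (measureReal_nonneg (μ := P) (s := B))] using
          abs_sub (P.real (A ∩ B) - q * P.real B) ((P.real A - q) * P.real B)
    _ ≤ c + c :=
        add_le_add hAB ((mul_le_of_le_one_right (abs_nonneg _) measureReal_le_one).trans hA)
    _ = 2 * c := (two_mul c).symm

namespace IIDWithLaw

variable {ξ : ℤ → Ω → F} {ν : Measure F} {f : E → F → E} {X : ℕ → Ω → E}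

theorem measureReal_inter_eq_setIntegral [IsProbabilityMeasure P] (h : IIDWithLaw P ξ ν)
    (hf : Measurable fun q : E × F => f q.1 q.2)
    (hX : ∀ n : ℕ, Measurable[sigmaOn ξ (Set.Iic (n : ℤ))] (X n))
    (hrec : ∀ n : ℕ, ∀ᵐ ω ∂P, X (n + 1) ω = f (X n ω) (ξ (n + 1) ω))
    {A : Set E} (hA : MeasurableSet A) {B : Set Ω} (hB : MeasurableSet[sigmaOn ξ (Set.Iic 0)] B)
    (n k : ℕ) :
    P.real (X (n + k) ⁻¹' A ∩ B) =
      ∫ ω in B, (transitionOp ν f)^[k] (A.indicator 1) (X n ω) ∂P := by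
  have hBm : MeasurableSet B := h.sigmaOn_le _ _ hB
  have hXA : MeasurableSet (X (n + k) ⁻¹' A) := (hX _).mono (h.sigmaOn_le _) le_rfl hA
  have hweight (F : Ω → ℝ) : ∫ ω in B, F ω ∂P = ∫ ω, B.indicator 1 ω * F ω ∂P := by
    rw [← integral_indicator hBm]
    exact integral_congr_ae (ae_of_all _ fun ω => by by_cases hω : ω ∈ B <;> simp [hω])
  calc P.real (X (n + k) ⁻¹' A ∩ B)
      = ∫ ω in B, A.indicator 1 (X (n + k) ω) ∂P := by
        rw [← measureReal_restrict_apply hXA, ← integral_indicator_one hXA]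
        rfl
    _ = ∫ ω in B, (transitionOp ν f)^[k] (A.indicator 1) (X n ω) ∂P := by
        rw [hweight, hweight]
        exact h.integral_mul_transitionOp_iterate hf hX hrec
          (Measurable.indicator (m := sigmaOn ξ (Set.Iic 0)) measurable_const hB)
          ((integrable_const 1).indicator hBm) (measurable_one.indicator hA)
          (abs_indicator_one_le A) n k

theorem measureReal_trajectory_inter (h : IIDWithLaw P ξ ν)
    (hf : Measurable fun q : E × F => f q.1 q.2) (x : E) (s : ℤ) (n : ℕ)
    {A : Set E} (hA : MeasurableSet A) {B : Set Ω} (hB : MeasurableSet[sigmaOn ξ (Set.Iic s)] B) :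
    P.real (trajectory f x ξ s n ⁻¹' A ∩ B) =
      P.real (trajectory f x ξ s n ⁻¹' A) * P.real B := by
  have hindep := h.indep_sigmaOn (I := Set.Ioc s (s + n)) (J := Set.Iic s)
    (Set.disjoint_left.2 fun i hi hi' => absurd hi.1 (not_lt.2 hi'))
  simp only [measureReal_def, ← ENNReal.toReal_mul,
    (Indep_iff _ _ _).1 hindep _ _ (measurable_trajectory hf x ξ s n hA) hB]

theorem abs_measureReal_inter_sub_trajectory_le [IsProbabilityMeasure P] (h : IIDWithLaw P ξ ν)
    (hf : Measurable fun q : E × F => f q.1 q.2)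
    (hX : ∀ n : ℕ, Measurable[sigmaOn ξ (Set.Iic (n : ℤ))] (X n))
    (hrec : ∀ n : ℕ, ∀ᵐ ω ∂P, X (n + 1) ω = f (X n ω) (ξ (n + 1) ω)) (x : E)
    {A : Set E} (hA : MeasurableSet A) {B : Set Ω} (hB : MeasurableSet[sigmaOn ξ (Set.Iic 0)] B)
    (n k : ℕ) :
    |P.real (X (n + k) ⁻¹' A ∩ B) - P.real (trajectory f x ξ 0 (n + k) ⁻¹' A) * P.real B| ≤
      ∫ ω, |(transitionOp ν f)^[k] (A.indicator 1) (X n ω) -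
        (transitionOp ν f)^[k] (A.indicator 1) (trajectory f x ξ 0 n ω)| ∂P := by
  have hν := h.isProbabilityMeasure_law
  have hZ (m : ℕ) : Measurable[sigmaOn ξ (Set.Iic (m : ℤ))] (trajectory f x ξ 0 m) :=
    (measurable_trajectory hf x ξ 0 m).mono
      (sigmaOn_mono ξ (by simpa only [zero_add] using Set.Ioc_subset_Iic_self)) le_rfl
  have hZrec (m : ℕ) : ∀ᵐ ω ∂P,
      trajectory f x ξ 0 (m + 1) ω = f (trajectory f x ξ 0 m ω) (ξ (m + 1) ω) :=
    ae_of_all _ fun ω => by simp only [trajectory, zero_add]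
  have hint {Y : Ω → E} (hY : Measurable[sigmaOn ξ (Set.Iic (n : ℤ))] Y) :
      Integrable (fun ω => (transitionOp ν f)^[k] (A.indicator 1) (Y ω)) P :=
    .of_bound ((measurable_transitionOp_iterate ν hf (measurable_one.indicator hA) k).comp
      (hY.mono (h.sigmaOn_le _) le_rfl)).aestronglyMeasurable 1
      (ae_of_all _ fun ω => abs_transitionOp_iterate_le ν f (abs_indicator_one_le A) k _)
  have hdiff := (hint (hX n)).sub (hint (hZ n))
  rw [← h.measureReal_trajectory_inter hf x 0 (n + k) hA hB,
    h.measureReal_inter_eq_setIntegral hf hX hrec hA hB,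
    h.measureReal_inter_eq_setIntegral hf hZ hZrec hA hB,
    ← integral_sub (hint (hX n)).restrict (hint (hZ n)).restrict]
  exact (abs_integral_le_integral_abs).trans
    (setIntegral_le_integral hdiff.abs (ae_of_all _ fun ω => abs_nonneg _))

theorem abs_measureReal_inter_sub_mul_le [IsProbabilityMeasure P] (h : IIDWithLaw P ξ ν)
    (hf : Measurable fun q : E × F => f q.1 q.2)
    (hX : ∀ n : ℕ, Measurable[sigmaOn ξ (Set.Iic (n : ℤ))] (X n))
    (hrec : ∀ n : ℕ, ∀ᵐ ω ∂P, X (n + 1) ω = f (X n ω) (ξ (n + 1) ω)) (x : E)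
    {A : Set E} (hA : MeasurableSet A) {B : Set Ω} (hB : MeasurableSet[sigmaOn ξ (Set.Iic 0)] B)
    (n k : ℕ) :
    |P.real (X (n + k) ⁻¹' A ∩ B) - P.real (X (n + k) ⁻¹' A) * P.real B| ≤
      2 * ∫ ω, |(transitionOp ν f)^[k] (A.indicator 1) (X n ω) -
        (transitionOp ν f)^[k] (A.indicator 1) (trajectory f x ξ 0 n ω)| ∂P :=
  ARCH.abs_measureReal_inter_sub_mul_le
    (h.abs_measureReal_inter_sub_trajectory_le hf hX hrec x hA hB n k) <| by
    simpa using h.abs_measureReal_inter_sub_trajectory_le hf hX hrec x hA .univ n k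

end IIDWithLaw

end RandomRecursion

section StateSpace

variable {p : ℕ}

/-- Shift register: put `x` in front of `u` and drop the last coordinate. -/
def pushFront (u : Fin p → ℝ) (x : ℝ) : Fin p → ℝ := Fin.init (Fin.cons x u : Fin (p + 1) → ℝ)

theorem pushFront_of_val_eq_zero {j : Fin p} (hj : (j : ℕ) = 0) (u : Fin p → ℝ) (x : ℝ) :
    pushFront u x j = x := by
  have : j.castSucc = 0 := Fin.ext hj
  simp only [pushFront, Fin.init, this, Fin.cons_zero]

theorem pushFront_of_val_eq_succ {i j : Fin p} (hij : (i : ℕ) + 1 = j) (u : Fin p → ℝ) (x : ℝ) :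
    pushFront u x j = u i := by
  have : j.castSucc = i.succ := Fin.ext hij.symm
  simp only [pushFront, Fin.init, this, Fin.cons_succ]

theorem val_eq_zero_or_exists_succ_eq (j : Fin p) :
    (j : ℕ) = 0 ∨ ∃ i : Fin p, (i : ℕ) + 1 = j := by
  rcases Nat.eq_zero_or_eq_succ_pred (j : ℕ) with hj | hj
  · exact .inl hj
  · exact .inr ⟨⟨(j : ℕ).pred, by omega⟩, hj.symm⟩

theorem measurable_pushFront : Measurable fun q : (Fin p → ℝ) × ℝ => pushFront q.1 q.2 := by
  refine measurable_pi_lambda _ fun j => ?_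
  rcases val_eq_zero_or_exists_succ_eq j with hj | ⟨i, hij⟩
  · simpa only [pushFront_of_val_eq_zero hj] using measurable_snd
  · simp only [pushFront_of_val_eq_succ hij]
    fun_prop

/-- The `ℓ¹` distance of the coordinatewise squares. -/
def sqDist (u v : Fin p → ℝ) : ℝ := ∑ j, |u j ^ 2 - v j ^ 2|

theorem sqDist_nonneg (u v : Fin p → ℝ) : 0 ≤ sqDist u v :=
  Finset.sum_nonneg fun _ _ => abs_nonneg _

theorem abs_sq_sub_sq_le_sqDist (u v : Fin p → ℝ) (j : Fin p) :
    |u j ^ 2 - v j ^ 2| ≤ sqDist u v :=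
  Finset.single_le_sum (f := fun j => |u j ^ 2 - v j ^ 2|) (fun _ _ => abs_nonneg _)
    (Finset.mem_univ j)

theorem measurable_sqDist {Ω : Type*} {m : MeasurableSpace Ω} {X Y : Ω → Fin p → ℝ}
    (hX : Measurable[m] X) (hY : Measurable[m] Y) : Measurable[m] fun ω => sqDist (X ω) (Y ω) := by
  unfold sqDist
  fun_prop

theorem sqDist_pushFront_le (u v : Fin p → ℝ) (x : ℝ) :
    sqDist (pushFront u x) (pushFront v x) ≤ sqDist u v := by
  calc sqDist (pushFront u x) (pushFront v x)
      ≤ ∑ j : Fin (p + 1), |(Fin.cons x u : Fin (p + 1) → ℝ) j ^ 2 -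
          (Fin.cons x v : Fin (p + 1) → ℝ) j ^ 2| := by
        rw [Fin.sum_univ_castSucc]
        exact le_add_of_nonneg_right (abs_nonneg _)
    _ = sqDist u v := by simp [Fin.sum_univ_succ, sqDist]

/-- One step of the recursion `y_t = σ(y_{t-1}, …, y_{t-p}) ε_t` on the state of the last `p`
values. -/
def volStep (σ : (Fin p → ℝ) → ℝ) (u : Fin p → ℝ) (e : ℝ) : Fin p → ℝ := pushFront u (σ u * e)

theorem measurable_volStep {σ : (Fin p → ℝ) → ℝ} (hσ : Measurable σ) :
    Measurable fun q : (Fin p → ℝ) × ℝ => volStep σ q.1 q.2 :=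
  measurable_pushFront.comp
    (measurable_fst.prodMk ((hσ.comp measurable_fst).mul measurable_snd))

end StateSpace

section Smoothing

variable {p : ℕ} {g : ℝ → ℝ}

/-- The law on `ℝ` with Lebesgue density `g`. -/
abbrev densityLaw (g : ℝ → ℝ) : Measure ℝ := volume.withDensity fun x => ENNReal.ofReal (g x)

theorem lintegral_ofReal_density [IsProbabilityMeasure (densityLaw g)] :
    ∫⁻ x, ENNReal.ofReal (g x) = 1 := by
  rw [← setLIntegral_univ, ← withDensity_apply _ .univ, measure_univ]

theorem integrable_density [IsProbabilityMeasure (densityLaw g)] (hgm : Measurable g)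
    (hg0 : ∀ x, 0 ≤ g x) : Integrable g :=
  (lintegral_ofReal_ne_top_iff_integrable hgm.aestronglyMeasurable (ae_of_all _ hg0)).1
    (lintegral_ofReal_density.trans_ne ENNReal.one_ne_top)

theorem integral_density [IsProbabilityMeasure (densityLaw g)] (hgm : Measurable g)
    (hg0 : ∀ x, 0 ≤ g x) : ∫ x, g x = 1 := by
  rw [integral_eq_lintegral_of_nonneg_ae (ae_of_all _ hg0) hgm.aestronglyMeasurable,
    lintegral_ofReal_density, ENNReal.toReal_one]

theorem transitionOp_densityLaw_volStep (hgm : Measurable g) (hg0 : ∀ x, 0 ≤ g x)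
    {σ : (Fin p → ℝ) → ℝ} {u : Fin p → ℝ} (hσ : 0 < σ u) (ψ : (Fin p → ℝ) → ℝ) :
    transitionOp (densityLaw g) (volStep σ) ψ u =
      ∫ z, ψ (pushFront u z) * scaledDensity g (σ u) z := by
  have hsubst := Measure.integral_comp_mul_left
    (fun z => ψ (pushFront u z) * scaledDensity g (σ u) z) (σ u)
  rw [abs_of_pos (inv_pos.2 hσ), smul_eq_mul, eq_inv_mul_iff_mul_eq₀ hσ.ne'] at hsubst
  rw [← hsubst, ← integral_const_mul, transitionOp,
    integral_withDensity_eq_integral_toReal_smul₀ hgm.ennreal_ofReal.aemeasurable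
      (ae_of_all _ fun _ => ENNReal.ofReal_lt_top)]
  refine integral_congr_ae (ae_of_all _ fun e => ?_)
  simp only [ENNReal.toReal_ofReal (hg0 e), smul_eq_mul, volStep, scaledDensity,
    inv_mul_cancel_left₀ hσ.ne']
  field_simp

theorem abs_integral_mul_sub_integral_mul_le {X : Type*} [MeasurableSpace X] {μ : Measure X}
    {F G f h : X → ℝ} {c : ℝ} (hF : AEStronglyMeasurable F μ) (hF1 : ∀ x, |F x| ≤ 1)
    (hG : AEStronglyMeasurable G μ) (hG1 : ∀ x, |G x| ≤ 1) (hFG : ∀ x, |F x - G x| ≤ c)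
    (hf : Integrable f μ) (hf0 : ∀ x, 0 ≤ f x) (hh : Integrable h μ) :
    |∫ x, F x * f x ∂μ - ∫ x, G x * h x ∂μ| ≤ c * ∫ x, f x ∂μ + ∫ x, |f x - h x| ∂μ := by
  have hFf : Integrable (fun x => F x * f x) μ := hf.bdd_mul hF (ae_of_all _ hF1)
  have hGh : Integrable (fun x => G x * h x) μ := hh.bdd_mul hG (ae_of_all _ hG1)
  have hfh : Integrable (fun x => |f x - h x|) μ := (hf.sub hh).abs
  rw [← integral_sub hFf hGh, ← integral_const_mul, ← integral_add (hf.const_mul c) hfh,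
    ← Real.norm_eq_abs]
  refine norm_integral_le_of_norm_le ((hf.const_mul c).add hfh) (ae_of_all _ fun x => ?_)
  calc |F x * f x - G x * h x| = |(F x - G x) * f x + G x * (f x - h x)| := by ring_nf
    _ ≤ |F x - G x| * f x + |G x| * |f x - h x| := by
        simpa only [abs_mul, abs_of_nonneg (hf0 x)] using
          abs_add_le ((F x - G x) * f x) (G x * (f x - h x))
    _ ≤ c * f x + |f x - h x| :=
        add_le_add (mul_le_mul_of_nonneg_right (hFG x) (hf0 x))
          (mul_le_of_le_one_left (abs_nonneg _) (hG1 x))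

/-- `ψ` is `L`-Lipschitz in the squared coordinates among states with the same first `k`
coordinates. Each step of the recursion lowers `k` by one. -/
def LipschitzBeyond (k : ℕ) (L : ℝ) (ψ : (Fin p → ℝ) → ℝ) : Prop :=
  ∀ u v : Fin p → ℝ, (∀ j : Fin p, (j : ℕ) < k → u j = v j) → |ψ u - ψ v| ≤ L * sqDist u v

theorem LipschitzBeyond.abs_pushFront_sub_le {k : ℕ} {L : ℝ} {ψ : (Fin p → ℝ) → ℝ}
    (hψ : LipschitzBeyond (k + 1) L ψ) (hL : 0 ≤ L) {u v : Fin p → ℝ}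
    (huv : ∀ j : Fin p, (j : ℕ) < k → u j = v j) (z : ℝ) :
    |ψ (pushFront u z) - ψ (pushFront v z)| ≤ L * sqDist u v := by
  refine (hψ _ _ fun j hj => ?_).trans (mul_le_mul_of_nonneg_left (sqDist_pushFront_le u v z) hL)
  rcases val_eq_zero_or_exists_succ_eq j with hj0 | ⟨i, hij⟩
  · simp only [pushFront_of_val_eq_zero hj0]
  · simpa only [pushFront_of_val_eq_succ hij] using huv i (by omega)

variable [IsProbabilityMeasure (densityLaw g)] {σ ψ : (Fin p → ℝ) → ℝ} {S : ℝ}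

-- After the substitution `z = σ(u) e` the new coordinate `z` is common to both states, and `σ(u)`
-- enters only through the density of `z`, which is Lipschitz in the scale.
theorem LipschitzBeyond.transitionOp_volStep {k : ℕ} {L : ℝ} (h : LipschitzBeyond (k + 1) L ψ)
    (hL : 0 ≤ L) (hψ : Measurable ψ) (hψ1 : ∀ u, |ψ u| ≤ 1)
    (hg : Differentiable ℝ g) (hg0 : ∀ x, 0 ≤ g x) (hg' : Integrable fun x => deriv g x * x)
    (hσ1 : ∀ u, 1 ≤ σ u) (hσ : ∀ u v, |σ u ^ 2 - σ v ^ 2| ≤ S * sqDist u v) :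
    LipschitzBeyond k (L + scaleSpeed g * S) (transitionOp (densityLaw g) (volStep σ) ψ) := by
  intro u v huv
  have hgm := hg.continuous.measurable
  have hgi := integrable_density hgm hg0
  have hσ0 (w : Fin p → ℝ) : 0 < σ w := zero_lt_one.trans_le (hσ1 w)
  have hψpush (w : Fin p → ℝ) : AEStronglyMeasurable (fun z => ψ (pushFront w z)) volume :=
    (hψ.comp (measurable_pushFront.comp measurable_prodMk_left)).aestronglyMeasurable
  rw [transitionOp_densityLaw_volStep hgm hg0 (hσ0 u),
    transitionOp_densityLaw_volStep hgm hg0 (hσ0 v)]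
  calc |(∫ z, ψ (pushFront u z) * scaledDensity g (σ u) z) -
          ∫ z, ψ (pushFront v z) * scaledDensity g (σ v) z|
      ≤ L * sqDist u v * (∫ z, scaledDensity g (σ u) z) +
          ∫ z, |scaledDensity g (σ u) z - scaledDensity g (σ v) z| :=
        abs_integral_mul_sub_integral_mul_le (hψpush u) (fun z => hψ1 _) (hψpush v)
          (fun z => hψ1 _) (h.abs_pushFront_sub_le hL huv) (integrable_scaledDensity hgi (hσ0 u))
          (fun z => mul_nonneg (inv_pos.2 (hσ0 u)).le (hg0 _))
          (integrable_scaledDensity hgi (hσ0 v))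
    _ ≤ L * sqDist u v + scaleSpeed g * |σ u ^ 2 - σ v ^ 2| := by
        rw [integral_scaledDensity g (hσ0 u), integral_density hgm hg0, mul_one]
        exact add_le_add le_rfl (integral_abs_scaledDensity_sub_le hg hgi hg' (hσ1 u) (hσ1 v))
    _ ≤ L * sqDist u v + scaleSpeed g * (S * sqDist u v) :=
        add_le_add le_rfl (mul_le_mul_of_nonneg_left (hσ u v) (scaleSpeed_nonneg g))
    _ = (L + scaleSpeed g * S) * sqDist u v := by ring

theorem lipschitzBeyond_transitionOp_iterate
    (hg : Differentiable ℝ g) (hg0 : ∀ x, 0 ≤ g x) (hg' : Integrable fun x => deriv g x * x)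
    (hσ1 : ∀ u, 1 ≤ σ u) (hσ : ∀ u v, |σ u ^ 2 - σ v ^ 2| ≤ S * sqDist u v)
    (hσm : Measurable σ) (hS : 0 ≤ S) (hψ : Measurable ψ) (hψ1 : ∀ u, |ψ u| ≤ 1) {n : ℕ}
    (hn : n ≤ p) :
    LipschitzBeyond (p - n) (n * (scaleSpeed g * S))
      ((transitionOp (densityLaw g) (volStep σ))^[n] ψ) := by
  induction n with
  | zero =>
    intro u v huv
    have : u = v := funext fun j => huv j j.isLt
    simp [this]
  | succ n ih =>
    have hn' : p - n = p - (n + 1) + 1 := by omega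
    have hstep := LipschitzBeyond.transitionOp_volStep (hn' ▸ ih (Nat.le_of_succ_le hn))
      (mul_nonneg n.cast_nonneg (mul_nonneg (scaleSpeed_nonneg g) hS))
      (measurable_transitionOp_iterate _ (measurable_volStep hσm) hψ n)
      (abs_transitionOp_iterate_le _ _ hψ1 n) hg hg0 hg' hσ1 hσ
    rw [Function.iterate_succ_apply']
    push_cast
    rwa [add_mul, one_mul]

theorem abs_transitionOp_iterate_sub_le
    (hg : Differentiable ℝ g) (hg0 : ∀ x, 0 ≤ g x) (hg' : Integrable fun x => deriv g x * x)
    (hσ1 : ∀ u, 1 ≤ σ u) (hσ : ∀ u v, |σ u ^ 2 - σ v ^ 2| ≤ S * sqDist u v)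
    (hσm : Measurable σ) (hS : 0 ≤ S) (hψ : Measurable ψ) (hψ1 : ∀ u, |ψ u| ≤ 1)
    (u v : Fin p → ℝ) :
    |(transitionOp (densityLaw g) (volStep σ))^[p] ψ u -
        (transitionOp (densityLaw g) (volStep σ))^[p] ψ v| ≤
      p * (scaleSpeed g * S) * sqDist u v :=
  lipschitzBeyond_transitionOp_iterate hg hg0 hg' hσ1 hσ hσm hS hψ hψ1 le_rfl u v
    fun j hj => absurd hj (by omega)

end Smoothing

section SquareRecursion

variable {p : ℕ} {Ω : Type*} {a : Fin p → ℝ}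

/-- The ARCH volatility `σ(u) = (1 + a₁ u₁² + … + a_p u_p²)^{1/2}`. -/
def volatility (a u : Fin p → ℝ) : ℝ := √(1 + ∑ j, a j * u j ^ 2)

/-- The affine map `w ↦ (q (c + a₁ w₁ + … + a_p w_p), w₁, …, w_{p-1})`. -/
def affineStep (c : ℝ) (a : Fin p → ℝ) (q : ℝ) (w : Fin p → ℝ) : Fin p → ℝ :=
  pushFront w ((c + ∑ j, a j * w j) * q)

/-- The random affine recursion driven by squared innovations. With `c = 1` it is satisfied by
squared ARCH states, with `c = 0` it dominates differences of such. -/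
def squareStep (c : ℝ) (a w : Fin p → ℝ) (e : ℝ) : Fin p → ℝ := affineStep c a (e ^ 2) w

theorem measurable_volatility (a : Fin p → ℝ) : Measurable (volatility a) := by
  unfold volatility
  fun_prop

theorem measurable_squareStep (c : ℝ) (a : Fin p → ℝ) :
    Measurable fun q : (Fin p → ℝ) × ℝ => squareStep c a q.1 q.2 :=
  measurable_pushFront.comp (measurable_fst.prodMk (by fun_prop))

theorem one_add_sum_mul_sq_ge_one (ha : ∀ j, 0 ≤ a j) (u : Fin p → ℝ) :
    1 ≤ 1 + ∑ j, a j * u j ^ 2 :=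
  le_add_of_nonneg_right (Finset.sum_nonneg fun j _ => mul_nonneg (ha j) (sq_nonneg _))

theorem volatility_sq (ha : ∀ j, 0 ≤ a j) (u : Fin p → ℝ) :
    volatility a u ^ 2 = 1 + ∑ j, a j * u j ^ 2 :=
  Real.sq_sqrt (zero_le_one.trans (one_add_sum_mul_sq_ge_one ha u))

theorem one_le_volatility (ha : ∀ j, 0 ≤ a j) (u : Fin p → ℝ) : 1 ≤ volatility a u :=
  Real.one_le_sqrt.2 (one_add_sum_mul_sq_ge_one ha u)

theorem abs_volatility_sq_sub_le (ha : ∀ j, 0 ≤ a j) (u v : Fin p → ℝ) :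
    |volatility a u ^ 2 - volatility a v ^ 2| ≤ ∑ j, a j * |u j ^ 2 - v j ^ 2| := by
  rw [volatility_sq ha, volatility_sq ha, add_sub_add_left_eq_sub, ← Finset.sum_sub_distrib]
  refine (Finset.abs_sum_le_sum_abs _ _).trans_eq (Finset.sum_congr rfl fun j _ => ?_)
  rw [← mul_sub, abs_mul, abs_of_nonneg (ha j)]

theorem abs_volatility_sq_sub_le_sqDist (ha : ∀ j, 0 ≤ a j) (u v : Fin p → ℝ) :
    |volatility a u ^ 2 - volatility a v ^ 2| ≤ (∑ j, a j) * sqDist u v := by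
  refine (abs_volatility_sq_sub_le ha u v).trans ?_
  rw [Finset.sum_mul]
  exact Finset.sum_le_sum fun j _ =>
    mul_le_mul_of_nonneg_left (abs_sq_sub_sq_le_sqDist u v j) (ha j)

theorem sq_volStep_volatility (ha : ∀ j, 0 ≤ a j) (u : Fin p → ℝ) (e : ℝ) (j : Fin p) :
    volStep (volatility a) u e j ^ 2 = squareStep 1 a (fun i => u i ^ 2) e j := by
  unfold volStep squareStep affineStep
  rcases val_eq_zero_or_exists_succ_eq j with hj | ⟨i, hij⟩
  · simp only [pushFront_of_val_eq_zero hj, mul_pow, volatility_sq ha]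
  · simp only [pushFront_of_val_eq_succ hij]

theorem abs_sq_volStep_sub_le (ha : ∀ j, 0 ≤ a j) {u v w : Fin p → ℝ} {M : ℝ}
    (huv : ∀ j, |u j ^ 2 - v j ^ 2| ≤ M * w j) (e : ℝ) (j : Fin p) :
    |volStep (volatility a) u e j ^ 2 - volStep (volatility a) v e j ^ 2| ≤
      M * squareStep 0 a w e j := by
  unfold volStep squareStep affineStep
  rcases val_eq_zero_or_exists_succ_eq j with hj | ⟨i, hij⟩
  · simp only [pushFront_of_val_eq_zero hj, mul_pow, ← sub_mul, abs_mul, abs_sq, zero_add]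
    rw [← mul_assoc, Finset.mul_sum]
    refine mul_le_mul_of_nonneg_right ((abs_volatility_sq_sub_le ha u v).trans
      (Finset.sum_le_sum fun i _ => ?_)) (sq_nonneg e)
    rw [mul_left_comm]
    exact mul_le_mul_of_nonneg_left (huv i) (ha i)
  · simpa only [pushFront_of_val_eq_succ hij] using huv i

theorem sq_trajectory_volStep_volatility (ha : ∀ j, 0 ≤ a j) (u : Fin p → ℝ) (ε : ℤ → Ω → ℝ)
    (s : ℤ) (n : ℕ) (ω : Ω) (j : Fin p) :
    trajectory (volStep (volatility a)) u ε s n ω j ^ 2 =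
      trajectory (squareStep 1 a) (fun i => u i ^ 2) ε s n ω j := by
  induction n generalizing j with
  | zero => rfl
  | succ n ih => simp only [trajectory, sq_volStep_volatility ha, ih]

theorem abs_sq_sub_sq_trajectory_le (ha : ∀ j, 0 ≤ a j) (ε : ℤ → Ω → ℝ)
    (Y : ℤ → Ω → Fin p → ℝ) {ω : Ω}
    (hY : ∀ t, Y (t + 1) ω = volStep (volatility a) (Y t ω) (ε (t + 1) ω))
    (s : ℤ) (n : ℕ) (j : Fin p) :
    |Y (s + n) ω j ^ 2 - trajectory (volStep (volatility a)) 0 ε s n ω j ^ 2| ≤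
      sqDist (Y s ω) 0 * trajectory (squareStep 0 a) 1 ε s n ω j := by
  induction n generalizing j with
  | zero =>
    simpa only [trajectory, Nat.cast_zero, add_zero, Pi.one_apply, mul_one] using
      abs_sq_sub_sq_le_sqDist (Y s ω) 0 j
  | succ n ih =>
    rw [Nat.cast_succ, ← add_assoc, hY]
    exact abs_sq_volStep_sub_le ha ih _ j

theorem affineStep_nonneg {c q : ℝ} {w : Fin p → ℝ} (ha : ∀ j, 0 ≤ a j) (hc : 0 ≤ c) (hq : 0 ≤ q)
    (hw : ∀ j, 0 ≤ w j) (j : Fin p) : 0 ≤ affineStep c a q w j := by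
  unfold affineStep
  rcases val_eq_zero_or_exists_succ_eq j with hj | ⟨i, hij⟩
  · rw [pushFront_of_val_eq_zero hj]
    exact mul_nonneg (add_nonneg hc (Finset.sum_nonneg fun i _ => mul_nonneg (ha i) (hw i))) hq
  · simpa only [pushFront_of_val_eq_succ hij] using hw i

theorem trajectory_squareStep_nonneg {c : ℝ} {w : Fin p → ℝ} (ha : ∀ j, 0 ≤ a j) (hc : 0 ≤ c)
    (hw : ∀ j, 0 ≤ w j) (ε : ℤ → Ω → ℝ) (s : ℤ) (n : ℕ) (ω : Ω) (j : Fin p) :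
    0 ≤ trajectory (squareStep c a) w ε s n ω j := by
  induction n generalizing j with
  | zero => exact hw j
  | succ n ih => exact affineStep_nonneg ha hc (sq_nonneg _) ih j

theorem iterate_affineStep_one_le {m κ : ℝ} (ha : ∀ j, 0 ≤ a j) (hm : 0 ≤ m) (hκ0 : 0 ≤ κ)
    (hκ : (1 + (∑ j, a j) * κ) * m ≤ κ) (n : ℕ) (j : Fin p) :
    (affineStep 1 a m)^[n] 0 j ≤ κ := by
  induction n generalizing j with
  | zero => exact hκ0
  | succ n ih =>
    rw [Function.iterate_succ_apply', affineStep]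
    rcases val_eq_zero_or_exists_succ_eq j with hj | ⟨i, hij⟩
    · rw [pushFront_of_val_eq_zero hj]
      refine le_trans (mul_le_mul_of_nonneg_right (add_le_add le_rfl ?_) hm) hκ
      rw [Finset.sum_mul]
      exact Finset.sum_le_sum fun i _ => mul_le_mul_of_nonneg_left (ih i) (ha i)
    · simpa only [pushFront_of_val_eq_succ hij] using ih i

-- The weight `θ ^ j` makes each shift cost exactly one factor `θ`.
theorem iterate_affineStep_zero_mul_pow_le {m θ : ℝ} (ha : ∀ j, 0 ≤ a j) (hm : 0 ≤ m)
    (hθ : 0 < θ) (hθ1 : θ ≤ 1) (haθ : (∑ j, a j) * m ≤ θ ^ p) (n : ℕ) (j : Fin p) :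
    (affineStep 0 a m)^[n] 1 j * θ ^ (j : ℕ) ≤ θ ^ n := by
  induction n generalizing j with
  | zero => simpa using pow_le_one₀ hθ.le hθ1
  | succ n ih =>
    rw [Function.iterate_succ_apply', affineStep]
    rcases val_eq_zero_or_exists_succ_eq j with hj | ⟨i, hij⟩
    · have hcoord (i : Fin p) : (affineStep 0 a m)^[n] 1 i ≤ θ ^ (n + 1) / θ ^ p := by
        rw [le_div_iff₀ (pow_pos hθ p)]
        calc (affineStep 0 a m)^[n] 1 i * θ ^ p
            = (affineStep 0 a m)^[n] 1 i * θ ^ (i : ℕ) * θ ^ (p - i) := by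
              rw [mul_assoc, ← pow_add, Nat.add_sub_cancel' i.isLt.le]
          _ ≤ θ ^ n * θ ^ 1 :=
              mul_le_mul (ih i) (pow_le_pow_of_le_one hθ.le hθ1 (by omega)) (by positivity)
                (by positivity)
          _ = θ ^ (n + 1) := (pow_add θ n 1).symm
      rw [pushFront_of_val_eq_zero hj, hj, pow_zero, mul_one, zero_add]
      calc (∑ i, a i * (affineStep 0 a m)^[n] 1 i) * m
          ≤ (∑ i, a i * (θ ^ (n + 1) / θ ^ p)) * m :=
            mul_le_mul_of_nonneg_right (Finset.sum_le_sum fun i _ =>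
              mul_le_mul_of_nonneg_left (hcoord i) (ha i)) hm
        _ = ((∑ i, a i) * m) * (θ ^ (n + 1) / θ ^ p) := by rw [← Finset.sum_mul]; ring
        _ ≤ θ ^ p * (θ ^ (n + 1) / θ ^ p) := mul_le_mul_of_nonneg_right haθ (by positivity)
        _ = θ ^ (n + 1) := mul_div_cancel₀ _ (pow_pos hθ p).ne'
    · rw [pushFront_of_val_eq_succ hij, ← hij, pow_succ, pow_succ, ← mul_assoc]
      exact mul_le_mul_of_nonneg_right (ih i) hθ.le

theorem exists_pow_ge_of_lt_one {x : ℝ} (hx : x < 1) (p : ℕ) : ∃ θ, 0 < θ ∧ θ < 1 ∧ x ≤ θ ^ p := by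
  have hlim : Tendsto (fun θ : ℝ => θ ^ p) (𝓝[<] 1) (𝓝 1) := by
    simpa using ((continuous_pow p).tendsto (1 : ℝ)).mono_left nhdsWithin_le_nhds
  obtain ⟨θ, hxθ, hθ0, hθ1⟩ :=
    ((hlim.eventually_const_le hx).and (Ioo_mem_nhdsLT (zero_lt_one (α := ℝ)))).exists
  exact ⟨θ, hθ0, hθ1, hxθ⟩

variable [MeasurableSpace Ω] {P : Measure Ω} {ε : ℤ → Ω → ℝ} {ν : Measure ℝ}

theorem IIDWithLaw.integral_mul_sq (h : IIDWithLaw P ε ν) (hν : Integrable (fun e => e ^ 2) ν)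
    {I : Set ℤ} {t : ℤ} (ht : t ∉ I) {X : Ω → ℝ} (hX : Measurable[sigmaOn ε I] X)
    (hXi : Integrable X P) :
    Integrable (fun ω => X ω * ε t ω ^ 2) P ∧
      ∫ ω, X ω * ε t ω ^ 2 ∂P = (∫ ω, X ω ∂P) * ∫ e, e ^ 2 ∂ν := by
  have hsq : AEStronglyMeasurable (fun e : ℝ => e ^ 2) (P.map (ε t)) :=
    (measurable_id.pow_const 2).aestronglyMeasurable
  have hεi : Integrable (fun ω => ε t ω ^ 2) P := by
    rw [← h.law t] at hν
    exact hν.comp_measurable (h.measurable t)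
  have hindep : IndepFun X (fun ω => ε t ω ^ 2) P :=
    (h.indepFun_of_notMem ht hX).comp measurable_id (measurable_id.pow_const 2)
  refine ⟨hindep.integrable_mul hXi hεi, ?_⟩
  rw [hindep.integral_fun_mul_eq_mul_integral hXi.1 hεi.1, ← h.law t,
    integral_map (h.measurable t).aemeasurable hsq]

theorem IIDWithLaw.integral_trajectory_squareStep [IsProbabilityMeasure P]
    (h : IIDWithLaw P ε ν) (hν : Integrable (fun e => e ^ 2) ν) (c : ℝ) (a w : Fin p → ℝ) (s : ℤ)
    (n : ℕ) (j : Fin p) :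
    Integrable (fun ω => trajectory (squareStep c a) w ε s n ω j) P ∧
      ∫ ω, trajectory (squareStep c a) w ε s n ω j ∂P =
        (affineStep c a (∫ e, e ^ 2 ∂ν))^[n] w j := by
  induction n generalizing j with
  | zero => simp [trajectory]
  | succ n ih =>
    simp only [trajectory, squareStep, affineStep, Function.iterate_succ_apply']
    rcases val_eq_zero_or_exists_succ_eq j with hj | ⟨i, hij⟩
    · simp only [pushFront_of_val_eq_zero hj]
      have hpast : Measurable[sigmaOn ε (Set.Ioc s (s + n))]
          fun ω => c + ∑ j, a j * trajectory (squareStep c a) w ε s n ω j :=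
        Measurable.comp (g := fun w : Fin p → ℝ => c + ∑ j, a j * w j) (by fun_prop)
          (measurable_trajectory (measurable_squareStep c a) w ε s n)
      have hterm (j : Fin p) (_ : j ∈ Finset.univ) :
          Integrable (fun ω => a j * trajectory (squareStep c a) w ε s n ω j) P :=
        (ih j).1.const_mul _
      have hsum := integrable_finsetSum _ hterm
      obtain ⟨hint, heq⟩ := h.integral_mul_sq hν (t := s + n + 1) (by simp) hpast
        ((integrable_const c).add hsum)
      refine ⟨hint, heq.trans ?_⟩
      rw [integral_add (integrable_const c) hsum, integral_finsetSum _ hterm]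
      simp only [integral_const_mul, (ih _).2, integral_const, probReal_univ, one_smul]
    · simpa only [pushFront_of_val_eq_succ hij] using ih i

theorem IIDWithLaw.integral_trajectory_squareStep_zero_le [IsProbabilityMeasure P]
    (h : IIDWithLaw P ε ν) (hν : Integrable (fun e => e ^ 2) ν) (ha : ∀ j, 0 ≤ a j) {θ : ℝ}
    (hθ : 0 < θ) (hθ1 : θ ≤ 1) (haθ : (∑ j, a j) * ∫ e, e ^ 2 ∂ν ≤ θ ^ p) (s : ℤ) (n : ℕ)
    (j : Fin p) :
    ∫ ω, trajectory (squareStep 0 a) 1 ε s n ω j ∂P ≤ θ⁻¹ ^ p * θ ^ n := by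
  have hnonneg : 0 ≤ ∫ ω, trajectory (squareStep 0 a) 1 ε s n ω j ∂P := integral_nonneg fun ω =>
    trajectory_squareStep_nonneg ha le_rfl (fun _ => zero_le_one) ε s n ω j
  rw [inv_pow, inv_mul_eq_div, le_div_iff₀ (pow_pos hθ p)]
  refine (mul_le_mul_of_nonneg_left (pow_le_pow_of_le_one hθ.le hθ1 j.isLt.le) hnonneg).trans ?_
  rw [(h.integral_trajectory_squareStep hν 0 a 1 s n j).2]
  exact iterate_affineStep_zero_mul_pow_le ha (integral_nonneg fun e => sq_nonneg e) hθ hθ1 haθ n j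

theorem IIDWithLaw.integral_sq_trajectory_volStep_le [IsProbabilityMeasure P]
    (h : IIDWithLaw P ε ν) (hν : Integrable (fun e => e ^ 2) ν) (ha : ∀ j, 0 ≤ a j)
    (ha1 : (∑ j, a j) * ∫ e, e ^ 2 ∂ν < 1) (s : ℤ) (n : ℕ) (j : Fin p) :
    Integrable (fun ω => trajectory (volStep (volatility a)) 0 ε s n ω j ^ 2) P ∧
      ∫ ω, trajectory (volStep (volatility a)) 0 ε s n ω j ^ 2 ∂P ≤
        (∫ e, e ^ 2 ∂ν) / (1 - (∑ j, a j) * ∫ e, e ^ 2 ∂ν) := by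
  set m := ∫ e, e ^ 2 ∂ν
  have hm : 0 ≤ m := integral_nonneg fun e => sq_nonneg e
  have hgap : 0 < 1 - (∑ j, a j) * m := sub_pos.2 ha1
  have hstart : (fun i => (0 : Fin p → ℝ) i ^ 2) = 0 := by simp [← Pi.zero_def]
  simp only [sq_trajectory_volStep_volatility ha, hstart]
  obtain ⟨hint, heq⟩ := h.integral_trajectory_squareStep hν 1 a 0 s n j
  refine ⟨hint, heq.le.trans (iterate_affineStep_one_le ha hm (div_nonneg hm hgap.le) ?_ n j)⟩
  exact le_of_eq (by field_simp; ring)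

end SquareRecursion

section ConvergenceInMeasure

variable {Ω : Type*} [MeasurableSpace Ω] {P : Measure Ω}

theorem tendstoInMeasure_of_norm_sub_le_mul {ι E : Type*} [SeminormedAddCommGroup E]
    {l : Filter ι} {f : ι → Ω → E} {x : Ω → E} {M W : ι → Ω → ℝ} (hM : ∀ i, Measurable (M i))
    (htight : IsTightMeasureSet (Set.range fun i => P.map (M i)))
    (hW : TendstoInMeasure P W l 0)
    (hfx : ∀ i, ∀ᵐ ω ∂P, ‖f i ω - x ω‖ ≤ ‖M i ω‖ * ‖W i ω‖) : TendstoInMeasure P f l x := by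
  rw [tendstoInMeasure_iff_norm] at hW ⊢
  intro η hη
  rw [ENNReal.tendsto_nhds_zero]
  intro c hc
  have hc2 : 0 < c / 2 := ENNReal.half_pos hc.ne'
  obtain ⟨K, hMK, hK⟩ := ((ENNReal.tendsto_nhds_zero.1
    (tendsto_measure_norm_gt_of_isTightMeasureSet htight) _ hc2).and (eventually_gt_atTop 0)).exists
  filter_upwards [ENNReal.tendsto_nhds_zero.1 (hW (η / K) (div_pos hη hK)) _ hc2] with i hWi
  have hMi : P {ω | K < ‖M i ω‖} ≤ c / 2 := by
    refine le_trans ?_ ((iSup₂_le_iff.1 hMK) (P.map (M i)) (Set.mem_range_self i))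
    rw [Measure.map_apply (hM i) (measurableSet_lt measurable_const measurable_norm)]
    rfl
  calc P {ω | η ≤ ‖f i ω - x ω‖}
      ≤ P ({ω | K < ‖M i ω‖} ∪ {ω | η / K ≤ ‖W i ω - 0‖}) := by
        refine measure_mono_ae ?_
        filter_upwards [hfx i] with ω hω hfar
        refine or_iff_not_imp_left.2 fun hle => (div_le_iff₀' hK).2 ?_
        rw [sub_zero]
        exact (hfar.trans hω).trans (mul_le_mul_of_nonneg_right (not_lt.1 hle) (norm_nonneg _))
    _ ≤ c / 2 + c / 2 := (measure_union_le _ _).trans (add_le_add hMi hWi)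
    _ = c := ENNReal.add_halves c

theorem tendstoInMeasure_zero_of_tendsto_integral_norm {ι E : Type*} [NormedAddCommGroup E]
    {l : Filter ι} {f : ι → Ω → E} (hf : ∀ i, Integrable (f i) P)
    (hlim : Tendsto (fun i => ∫ ω, ‖f i ω‖ ∂P) l (𝓝 0)) : TendstoInMeasure P f l 0 := by
  refine tendstoInMeasure_of_tendsto_eLpNorm one_ne_zero (fun i => (hf i).1)
    aestronglyMeasurable_zero ?_
  simp only [sub_zero, eLpNorm_one_eq_lintegral_enorm,
    ← ofReal_integral_norm_eq_lintegral_enorm (hf _)]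
  exact ENNReal.ofReal_zero ▸ ENNReal.tendsto_ofReal hlim

theorem integral_norm_le_of_tendstoInMeasure {E : Type*} [NormedAddCommGroup E] {f : ℕ → Ω → E}
    {x : Ω → E} (hfx : TendstoInMeasure P f atTop x) (hf : ∀ n, Integrable (f n) P)
    (hx : AEStronglyMeasurable x P) {C : ℝ} (hC : ∀ n, ∫ ω, ‖f n ω‖ ∂P ≤ C) :
    Integrable x P ∧ ∫ ω, ‖x ω‖ ∂P ≤ C := by
  have hC0 : 0 ≤ C := (integral_nonneg fun ω => norm_nonneg (f 0 ω)).trans (hC 0)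
  have hbound (n : ℕ) : eLpNorm (f n) 1 P ≤ ENNReal.ofReal C := by
    rw [eLpNorm_one_eq_lintegral_enorm, ← ofReal_integral_norm_eq_lintegral_enorm (hf n)]
    exact ENNReal.ofReal_le_ofReal (hC n)
  have hlim : eLpNorm x 1 P ≤ ENNReal.ofReal C :=
    eLpNorm_le_of_tendstoInMeasure (.of_forall hbound) hfx fun n => (hf n).1
  have hxi : Integrable x P :=
    memLp_one_iff_integrable.1 ⟨hx, hlim.trans_lt ENNReal.ofReal_lt_top⟩
  rw [eLpNorm_one_eq_lintegral_enorm, ← ofReal_integral_norm_eq_lintegral_enorm hxi,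
    ENNReal.ofReal_le_ofReal_iff hC0] at hlim
  exact ⟨hxi, hlim⟩

theorem exists_measurable_ae_eq_of_tendstoInMeasure {m : MeasurableSpace Ω} {f : ℕ → Ω → ℝ}
    {x : Ω → ℝ} (hf : ∀ n, Measurable[m] (f n)) (h : TendstoInMeasure P f atTop x) :
    ∃ z : Ω → ℝ, Measurable[m] z ∧ x =ᵐ[P] z := by
  obtain ⟨ns, -, hns⟩ := h.exists_seq_tendsto_ae
  refine ⟨fun ω => limsup (fun i => f (ns i) ω) atTop, Measurable.limsup fun i => hf (ns i), ?_⟩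
  filter_upwards [hns] with ω hω
  exact hω.limsup_eq.symm

end ConvergenceInMeasure

section StationarySolutions

variable {p : ℕ} {Ω : Type*} {ε y : ℤ → Ω → ℝ} {a : Fin p → ℝ}

theorem lagVector_succ {x : ℤ → Ω → ℝ} {t : ℤ} {ω : Ω} {σ : (Fin p → ℝ) → ℝ}
    (h : x (t + 1) ω = σ (lagVector p x t ω) * ε (t + 1) ω) :
    lagVector p x (t + 1) ω = volStep σ (lagVector p x t ω) (ε (t + 1) ω) := by
  funext j
  unfold volStep
  rcases val_eq_zero_or_exists_succ_eq j with hj | ⟨i, hij⟩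
  · simpa only [pushFront_of_val_eq_zero hj, lagVector, hj, Nat.cast_zero, sub_zero] using h
  · simp only [pushFront_of_val_eq_succ hij, lagVector, ← hij]
    congr 1
    push_cast
    ring

theorem measurable_lagVector {m : MeasurableSpace Ω} {x : ℤ → Ω → ℝ} {t : ℤ}
    (hx : ∀ s ≤ t, Measurable[m] (x s)) : Measurable[m] (lagVector p x t) :=
  measurable_pi_lambda _ fun j => hx _ (by omega)

variable [MeasurableSpace Ω] {P : Measure Ω}

theorem StrictlyStationary.map_lagVector (h : StrictlyStationary P y)
    (hm : ∀ t, Measurable (y t)) (s : ℤ) :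
    P.map (lagVector p y s) = P.map (lagVector p y 0) := by
  have hπ : Measurable fun (x : ℤ → ℝ) (j : Fin p) => x (0 - (j : ℕ)) := by fun_prop
  have hmap := congrArg (Measure.map fun (x : ℤ → ℝ) (j : Fin p) => x (0 - (j : ℕ))) (h s)
  rw [Measure.map_map hπ (by fun_prop), Measure.map_map hπ (by fun_prop)] at hmap
  convert hmap using 2
  · funext ω j
    simp only [lagVector, Function.comp_apply]
    congr 1
    ring
  · rfl

theorem IsStationarySolution.ae_lagVector_succ (hy : IsStationarySolution P ε a y) :
    ∀ᵐ ω ∂P, ∀ t, lagVector p y (t + 1) ω =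
      volStep (volatility a) (lagVector p y t ω) (ε (t + 1) ω) := by
  refine ae_all_iff.2 fun t => ?_
  filter_upwards [hy.equation (t + 1)] with ω hω
  rw [add_sub_cancel_right] at hω
  exact lagVector_succ hω

theorem IsStationarySolution.isTightMeasureSet_sqDist [IsFiniteMeasure P]
    (hy : IsStationarySolution P ε a y) :
    IsTightMeasureSet (Set.range fun t => P.map fun ω => sqDist (lagVector p y t ω) 0) := by
  refine (isTightMeasureSet_singleton
    (μ := (P.map (lagVector p y 0)).map fun u => sqDist u 0)).subset ?_
  rintro _ ⟨t, rfl⟩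
  have hsqDist : Measurable fun u : Fin p → ℝ => sqDist u 0 :=
    measurable_sqDist measurable_id measurable_const
  rw [← hy.stationary.map_lagVector hy.measurable t, Measure.map_map hsqDist
    (measurable_lagVector fun s _ => hy.measurable s)]
  rfl

variable [IsProbabilityMeasure P] {ν : Measure ℝ}

theorem IIDWithLaw.tendstoInMeasure_trajectory_squareStep (h : IIDWithLaw P ε ν)
    (hν : Integrable (fun e => e ^ 2) ν) (ha : ∀ j, 0 ≤ a j)
    (ha1 : (∑ j, a j) * ∫ e, e ^ 2 ∂ν < 1) (s : ℕ → ℤ) (j : Fin p) :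
    TendstoInMeasure P (fun n ω => trajectory (squareStep 0 a) 1 ε (s n) n ω j) atTop 0 := by
  obtain ⟨θ, hθ, hθ1, haθ⟩ := exists_pow_ge_of_lt_one ha1 p
  have hlim : Tendsto (fun n : ℕ => θ⁻¹ ^ p * θ ^ n) atTop (𝓝 0) := by
    simpa using (tendsto_pow_atTop_nhds_zero_of_lt_one hθ.le hθ1).const_mul (θ⁻¹ ^ p)
  refine tendstoInMeasure_zero_of_tendsto_integral_norm
    (fun n => (h.integral_trajectory_squareStep hν 0 a 1 (s n) n j).1)
    (squeeze_zero (fun n => integral_nonneg fun ω => norm_nonneg _) (fun n => ?_) hlim)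
  have hnorm (ω : Ω) : ‖trajectory (squareStep 0 a) 1 ε (s n) n ω j‖ = _ := Real.norm_of_nonneg
    (trajectory_squareStep_nonneg ha le_rfl (fun _ => zero_le_one) ε (s n) n ω j)
  simp only [hnorm]
  exact h.integral_trajectory_squareStep_zero_le hν ha hθ hθ1.le haθ (s n) n j

-- The initial state enters only through a factor that is tight by stationarity and is multiplied
-- by a factor vanishing in mean.
theorem IsStationarySolution.tendstoInMeasure_sq_trajectory (hy : IsStationarySolution P ε a y)
    (h : IIDWithLaw P ε ν) (hν : Integrable (fun e => e ^ 2) ν) (ha : ∀ j, 0 ≤ a j)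
    (ha1 : (∑ j, a j) * ∫ e, e ^ 2 ∂ν < 1) (t : ℤ) (j : Fin p) :
    TendstoInMeasure P
      (fun (n : ℕ) ω => trajectory (volStep (volatility a)) 0 ε (t - n) n ω j ^ 2) atTop
      fun ω => lagVector p y t ω j ^ 2 := by
  refine tendstoInMeasure_of_norm_sub_le_mul
    (M := fun n ω => sqDist (lagVector p y (t - n) ω) 0)
    (fun n => measurable_sqDist (measurable_lagVector fun s _ => hy.measurable s) measurable_const)
    (hy.isTightMeasureSet_sqDist.subset
      (Set.range_subset_iff.2 fun n => Set.mem_range_self (t - (n : ℤ))))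
    (h.tendstoInMeasure_trajectory_squareStep hν ha ha1 (fun n => t - n) j) fun n => ?_
  filter_upwards [hy.ae_lagVector_succ] with ω hω
  have hdiff := abs_sq_sub_sq_trajectory_le ha ε (lagVector p y) hω (t - n) n j
  rw [sub_add_cancel, abs_sub_comm] at hdiff
  refine hdiff.trans ?_
  rw [← norm_mul]
  exact le_abs_self _

theorem IsStationarySolution.integral_sq_lagVector_le (hy : IsStationarySolution P ε a y)
    (h : IIDWithLaw P ε ν) (hν : Integrable (fun e => e ^ 2) ν) (ha : ∀ j, 0 ≤ a j)
    (ha1 : (∑ j, a j) * ∫ e, e ^ 2 ∂ν < 1) (t : ℤ) (j : Fin p) :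
    Integrable (fun ω => lagVector p y t ω j ^ 2) P ∧
      ∫ ω, lagVector p y t ω j ^ 2 ∂P ≤ (∫ e, e ^ 2 ∂ν) / (1 - (∑ j, a j) * ∫ e, e ^ 2 ∂ν) := by
  have hmoment (n : ℕ) := h.integral_sq_trajectory_volStep_le hν ha ha1 (t - n) n j
  have hlim := integral_norm_le_of_tendstoInMeasure
    (hy.tendstoInMeasure_sq_trajectory h hν ha ha1 t j) (fun n => (hmoment n).1)
    ((hy.measurable _).pow_const 2).aestronglyMeasurable
    (fun n => by simpa only [norm_pow, Real.norm_eq_abs, sq_abs] using (hmoment n).2)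
  simpa only [norm_pow, Real.norm_eq_abs, sq_abs] using hlim

theorem IsStationarySolution.exists_adapted_version (hy : IsStationarySolution P ε a y)
    (h : IIDWithLaw P ε ν) (hν : Integrable (fun e => e ^ 2) ν) (ha : ∀ j, 0 ≤ a j)
    (ha1 : (∑ j, a j) * ∫ e, e ^ 2 ∂ν < 1) :
    ∃ x : ℤ → Ω → ℝ, (∀ t, Measurable[sigmaOn ε (Set.Iic t)] (x t)) ∧ ∀ t, y t =ᵐ[P] x t := by
  have hsq (t : ℤ) (j : Fin p) : ∃ z : Ω → ℝ, Measurable[sigmaOn ε (Set.Iic t)] z ∧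
      (fun ω => lagVector p y t ω j ^ 2) =ᵐ[P] z := by
    refine exists_measurable_ae_eq_of_tendstoInMeasure (fun n => ?_)
      (hy.tendstoInMeasure_sq_trajectory h hν ha ha1 t j)
    have htraj : Measurable[sigmaOn ε (Set.Iic t)]
        (trajectory (volStep (volatility a)) 0 ε (t - n) n) :=
      (measurable_trajectory (measurable_volStep (measurable_volatility a)) 0 ε (t - n) n).mono
        (sigmaOn_mono ε fun r hr => by simpa using hr.2) le_rfl
    exact Measurable.comp (g := fun w : Fin p → ℝ => w j ^ 2) (by fun_prop) htraj
  choose z hz hyz using hsq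
  refine ⟨fun t ω => √(1 + ∑ j, a j * z (t - 1) j ω) * ε t ω, fun t => ?_, fun t => ?_⟩
  · have hz' (j : Fin p) : Measurable[sigmaOn ε (Set.Iic t)] (z (t - 1) j) :=
      (hz (t - 1) j).mono (sigmaOn_mono ε (Set.Iic_subset_Iic.2 (by omega))) le_rfl
    have hε : Measurable[sigmaOn ε (Set.Iic t)] (ε t) := measurable_sigmaOn ε Set.self_mem_Iic
    fun_prop
  · filter_upwards [ae_all_iff.2 (hyz (t - 1)), hy.equation t] with ω hω heq
    simp only [heq, hω]

end StationarySolutions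

section Contraction

variable {p : ℕ} {Ω : Type*} {ε : ℤ → Ω → ℝ} {a : Fin p → ℝ} {Y : ℤ → Ω → Fin p → ℝ}

theorem sqDist_trajectory_le (ha : ∀ j, 0 ≤ a j) {ω : Ω}
    (hrec : ∀ t, Y (t + 1) ω = volStep (volatility a) (Y t ω) (ε (t + 1) ω)) (n : ℕ) :
    sqDist (Y n ω) (trajectory (volStep (volatility a)) 0 ε 0 n ω) ≤
      sqDist (Y 0 ω) 0 * ∑ j, trajectory (squareStep 0 a) 1 ε 0 n ω j := by
  rw [Finset.mul_sum]
  refine Finset.sum_le_sum fun j _ => ?_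
  simpa only [zero_add] using abs_sq_sub_sq_trajectory_le ha ε Y hrec 0 n j

variable [MeasurableSpace Ω] {P : Measure Ω} {ν : Measure ℝ}

theorem integral_sqDist_zero_le {X : Ω → Fin p → ℝ} {κ : ℝ}
    (hX : ∀ j, Integrable (fun ω => X ω j ^ 2) P ∧ ∫ ω, X ω j ^ 2 ∂P ≤ κ) :
    Integrable (fun ω => sqDist (X ω) 0) P ∧ ∫ ω, sqDist (X ω) 0 ∂P ≤ p * κ := by
  have hsum (ω : Ω) : sqDist (X ω) 0 = ∑ j, X ω j ^ 2 := by simp [sqDist]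
  simp only [hsum]
  refine ⟨integrable_finsetSum _ fun j _ => (hX j).1, ?_⟩
  rw [integral_finsetSum _ fun j _ => (hX j).1]
  simpa using Finset.sum_le_sum fun (j : Fin p) (_ : j ∈ Finset.univ) => (hX j).2

variable [IsProbabilityMeasure P]

theorem IIDWithLaw.integral_sum_trajectory_squareStep_zero_le (h : IIDWithLaw P ε ν)
    (hν : Integrable (fun e => e ^ 2) ν) (ha : ∀ j, 0 ≤ a j) {θ : ℝ} (hθ : 0 < θ) (hθ1 : θ ≤ 1)
    (haθ : (∑ j, a j) * ∫ e, e ^ 2 ∂ν ≤ θ ^ p) (s : ℤ) (n : ℕ) :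
    Integrable (fun ω => ∑ j, trajectory (squareStep 0 a) 1 ε s n ω j) P ∧
      ∫ ω, ∑ j, trajectory (squareStep 0 a) 1 ε s n ω j ∂P ≤ p * (θ⁻¹ ^ p * θ ^ n) := by
  have hint (j : Fin p) (_ : j ∈ Finset.univ) :=
    (h.integral_trajectory_squareStep hν 0 a 1 s n j).1
  refine ⟨integrable_finsetSum _ hint, ?_⟩
  rw [integral_finsetSum _ hint]
  simpa using Finset.sum_le_sum fun (j : Fin p) (_ : j ∈ Finset.univ) =>
    h.integral_trajectory_squareStep_zero_le hν ha hθ hθ1 haθ s n j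

theorem IIDWithLaw.integral_sqDist_trajectory_le (h : IIDWithLaw P ε ν)
    (hν : Integrable (fun e => e ^ 2) ν) (ha : ∀ j, 0 ≤ a j) {θ : ℝ} (hθ : 0 < θ) (hθ1 : θ ≤ 1)
    (haθ : (∑ j, a j) * ∫ e, e ^ 2 ∂ν ≤ θ ^ p)
    (hY : ∀ t, Measurable[sigmaOn ε (Set.Iic t)] (Y t))
    (hrec : ∀ᵐ ω ∂P, ∀ t, Y (t + 1) ω = volStep (volatility a) (Y t ω) (ε (t + 1) ω)) {κ : ℝ}
    (hmoment : ∀ j, Integrable (fun ω => Y 0 ω j ^ 2) P ∧ ∫ ω, Y 0 ω j ^ 2 ∂P ≤ κ) (n : ℕ) :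
    Integrable (fun ω => sqDist (Y n ω) (trajectory (volStep (volatility a)) 0 ε 0 n ω)) P ∧
      ∫ ω, sqDist (Y n ω) (trajectory (volStep (volatility a)) 0 ε 0 n ω) ∂P ≤
        p * κ * (p * (θ⁻¹ ^ p * θ ^ n)) := by
  set Z := trajectory (volStep (volatility a)) 0 ε 0 n
  set W : Ω → ℝ := fun ω => ∑ j, trajectory (squareStep 0 a) 1 ε 0 n ω j
  obtain ⟨hMi, hM⟩ := integral_sqDist_zero_le hmoment
  obtain ⟨hWi, hW⟩ := h.integral_sum_trajectory_squareStep_zero_le hν ha hθ hθ1 haθ 0 n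
  have hindep : IndepFun (fun ω => sqDist (Y 0 ω) 0) W P := by
    refine h.indepFun (J := Set.Ioc 0 (0 + n)) (Set.Iic_disjoint_Ioc le_rfl)
      (measurable_sqDist (hY 0) measurable_const) ?_
    exact Measurable.comp (g := fun w : Fin p → ℝ => ∑ j, w j) (by fun_prop)
      (measurable_trajectory (measurable_squareStep 0 a) 1 ε 0 n)
  have hprodi : Integrable (fun ω => sqDist (Y 0 ω) 0 * W ω) P := hindep.integrable_mul hMi hWi
  have hle : ∀ᵐ ω ∂P, sqDist (Y n ω) (Z ω) ≤ sqDist (Y 0 ω) 0 * W ω :=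
    hrec.mono fun ω hω => sqDist_trajectory_le ha hω n
  have hYn : Measurable (Y n) := (hY n).mono (h.sigmaOn_le _) le_rfl
  have hZ : Measurable Z := (measurable_trajectory (measurable_volStep (measurable_volatility a))
    0 ε 0 n).mono (h.sigmaOn_le _) le_rfl
  have hint : Integrable (fun ω => sqDist (Y n ω) (Z ω)) P := by
    refine hprodi.mono' (measurable_sqDist hYn hZ).aestronglyMeasurable ?_
    simpa only [Real.norm_of_nonneg (sqDist_nonneg _ _)] using hle
  refine ⟨hint, (integral_mono_ae hint hprodi hle).trans ?_⟩
  have hW0 : 0 ≤ ∫ ω, W ω ∂P := integral_nonneg fun ω => Finset.sum_nonneg fun j _ =>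
    trajectory_squareStep_nonneg ha le_rfl (fun _ => zero_le_one) ε 0 n ω j
  have hM0 : 0 ≤ ∫ ω, sqDist (Y 0 ω) 0 ∂P := integral_nonneg fun ω => sqDist_nonneg _ _
  exact (hindep.integral_fun_mul_eq_mul_integral hMi.1 hWi.1).trans_le
    (mul_le_mul hM hW hW0 (hM0.trans hM))

end Contraction

section StrongMixing

variable {Ω : Type*} {𝒜 : ℤ → MeasurableSpace Ω} {ℬ : MeasurableSpace Ω} [MeasurableSpace Ω]
  {P : Measure Ω} [IsProbabilityMeasure P]

theorem abs_measureReal_inter_sub_mul_le_one (A B : Set Ω) :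
    |P.real (A ∩ B) - P.real A * P.real B| ≤ 1 :=
  abs_sub_le_of_nonneg_of_le measureReal_nonneg measureReal_le_one
    (mul_nonneg measureReal_nonneg measureReal_nonneg)
    (mul_le_one₀ measureReal_le_one measureReal_nonneg measureReal_le_one)

theorem strongMixingCoeff_le_mul_exp {k : ℕ} {E θ : ℝ} (hθ : 0 < θ) (hθ1 : θ ≤ 1)
    (hcov : ∀ (n : ℕ) (A B : Set Ω), MeasurableSet[𝒜 (n + k)] A → MeasurableSet[ℬ] B →
      |P.real (A ∩ B) - P.real A * P.real B| ≤ E * θ ^ n) (t : ℤ) :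
    strongMixingCoeff P (𝒜 t) ℬ ≤ (E + 1) * θ⁻¹ ^ k * Real.exp (Real.log θ * t) := by
  have hE : 0 ≤ E := by
    simpa using (abs_nonneg _).trans (hcov 0 ∅ ∅ (@MeasurableSet.empty _ (𝒜 _))
      (@MeasurableSet.empty _ ℬ))
  have hbound : (E + 1) * θ⁻¹ ^ k * Real.exp (Real.log θ * t) = (E + 1) * θ ^ (t - k) := by
    rw [← Real.rpow_def_of_pos hθ, Real.rpow_intCast, mul_assoc, zpow_sub₀ hθ.ne', zpow_natCast,
      inv_pow, inv_mul_eq_div]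
  rw [hbound]
  refine Real.sSup_le ?_ (mul_nonneg (by linarith) (zpow_nonneg hθ.le _))
  rintro _ ⟨A, B, hA, hB, rfl⟩
  rcases le_or_gt (k : ℤ) t with ht | ht
  · obtain ⟨n, rfl⟩ := Int.le.dest ht
    rw [add_comm (k : ℤ)] at hA ⊢
    rw [add_sub_cancel_right, zpow_natCast]
    exact (hcov n A B hA hB).trans
      (mul_le_mul_of_nonneg_right (by linarith) (pow_nonneg hθ.le n))
  · exact (abs_measureReal_inter_sub_mul_le_one A B).trans
      (one_le_mul_of_one_le_of_one_le (by linarith)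
        (one_le_zpow_of_nonpos₀ hθ hθ1 (by omega)))

end StrongMixing

section CovarianceDecay

/-- The constant in the covariance bound for coefficients of sum `s` and innovations of second
moment `m`: the Lipschitz constant of the `p`-step transition operator, the second moment of a
stationary state and the constant of the contraction at rate `θ`. -/
def covarianceConst (p : ℕ) (g : ℝ → ℝ) (m θ s : ℝ) : ℝ :=
  2 * (p * (scaleSpeed g * s) * (p * (m / (1 - s * m)) * (p * θ⁻¹ ^ p)))

theorem covarianceConst_le_covarianceConst {p : ℕ} {g : ℝ → ℝ} {m θ s S : ℝ} (hm : 0 ≤ m)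
    (hθ : 0 ≤ θ) (hs : 0 ≤ s) (hsS : s ≤ S) (hS : S * m < 1) :
    covarianceConst p g m θ s ≤ covarianceConst p g m θ S := by
  have hgap : 0 < 1 - S * m := sub_pos.2 hS
  have hgap' : 0 < 1 - s * m := hgap.trans_le (by gcongr)
  have hspeed := scaleSpeed_nonneg g
  have hS0 : 0 ≤ S := hs.trans hsS
  unfold covarianceConst
  gcongr

variable {p : ℕ} {Ω : Type*} [MeasurableSpace Ω] {P : Measure Ω} {ε y : ℤ → Ω → ℝ}
  {g : ℝ → ℝ} {a : Fin p → ℝ}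

theorem exists_measurableSet_sigmaOn_ae_eq {x : ℤ → Ω → ℝ}
    (hx : ∀ t, Measurable[sigmaOn ε (Set.Iic t)] (x t)) (hyx : ∀ t, y t =ᵐ[P] x t) {B : Set Ω}
    (hB : MeasurableSet[sigmaPast y] B) :
    ∃ B', MeasurableSet[sigmaOn ε (Set.Iic 0)] B' ∧ B =ᵐ[P] B' := by
  have hle : sigmaPast y ≤ eventuallyMeasurableSpace (sigmaOn ε (Set.Iic 0)) (ae P) := by
    refine iSup_le fun s => Measurable.comap_le ?_
    have hxs : Measurable[sigmaOn ε (Set.Iic 0)] (x s) :=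
      (hx s).mono (sigmaOn_mono ε (Set.Iic_subset_Iic.2 s.2)) le_rfl
    exact hxs.eventuallyMeasurable_of_eventuallyEq (hyx s)
  exact hle B hB

theorem IIDWithDensity.iidWithLaw (h : IIDWithDensity P ε g) : IIDWithLaw P ε (densityLaw g) :=
  ⟨h.measurable, h.indep, h.law⟩

theorem IIDWithDensity.integral_sq_densityLaw (h : IIDWithDensity P ε g) {t : ℤ}
    (hsq : Integrable (fun ω => ε t ω ^ 2) P) :
    Integrable (fun e => e ^ 2) (densityLaw g) ∧
      ∫ e, e ^ 2 ∂(densityLaw g) = ∫ ω, ε t ω ^ 2 ∂P := by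
  have hε := (h.measurable t).aemeasurable (μ := P)
  have hmeas (μ : Measure ℝ) : AEStronglyMeasurable (fun e : ℝ => e ^ 2) μ :=
    (measurable_id.pow_const 2).aestronglyMeasurable
  rw [densityLaw, ← h.law t]
  exact ⟨(integrable_map_measure (hmeas _) hε).2 hsq, integral_map hε (hmeas _)⟩

variable [IsProbabilityMeasure P]

theorem IIDWithLaw.abs_measureReal_inter_sub_mul_le_pow (h : IIDWithLaw P ε (densityLaw g))
    (hg : Differentiable ℝ g) (hg0 : ∀ x, 0 ≤ g x) (hg' : Integrable fun x => deriv g x * x)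
    (hν : Integrable (fun e => e ^ 2) (densityLaw g)) (ha : ∀ j, 0 ≤ a j) {θ : ℝ} (hθ : 0 < θ)
    (hθ1 : θ ≤ 1) (haθ : (∑ j, a j) * ∫ e, e ^ 2 ∂(densityLaw g) ≤ θ ^ p)
    {Y : ℤ → Ω → Fin p → ℝ} (hY : ∀ t, Measurable[sigmaOn ε (Set.Iic t)] (Y t))
    (hrec : ∀ᵐ ω ∂P, ∀ t, Y (t + 1) ω = volStep (volatility a) (Y t ω) (ε (t + 1) ω)) {κ : ℝ}
    (hmoment : ∀ j, Integrable (fun ω => Y 0 ω j ^ 2) P ∧ ∫ ω, Y 0 ω j ^ 2 ∂P ≤ κ)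
    {A : Set (Fin p → ℝ)} (hA : MeasurableSet A) {B : Set Ω}
    (hB : MeasurableSet[sigmaOn ε (Set.Iic 0)] B) (n : ℕ) :
    |P.real (Y (n + p) ⁻¹' A ∩ B) - P.real (Y (n + p) ⁻¹' A) * P.real B| ≤
      2 * (p * (scaleSpeed g * ∑ j, a j) * (p * κ * (p * (θ⁻¹ ^ p * θ ^ n)))) := by
  have := h.isProbabilityMeasure_law
  obtain ⟨hint, hmean⟩ := h.integral_sqDist_trajectory_le hν ha hθ hθ1 haθ hY hrec hmoment n
  have hσ := measurable_volatility a
  have ha0 : 0 ≤ ∑ j, a j := Finset.sum_nonneg fun j _ => ha j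
  have hcov := h.abs_measureReal_inter_sub_mul_le (measurable_volStep hσ) (fun n => hY (n : ℤ))
    (fun n => hrec.mono fun ω hω => by exact_mod_cast hω n) 0 hA hB n p
  rw [Nat.cast_add] at hcov
  refine hcov.trans (mul_le_mul_of_nonneg_left ?_ zero_le_two)
  have hlip : 0 ≤ p * (scaleSpeed g * ∑ j, a j) := by
    have := scaleSpeed_nonneg g
    positivity
  refine le_trans ?_ (mul_le_mul_of_nonneg_left hmean hlip)
  rw [← integral_const_mul]
  refine integral_mono_of_nonneg (ae_of_all _ fun ω => abs_nonneg _) (hint.const_mul _)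
    (ae_of_all _ fun ω => ?_)
  exact abs_transitionOp_iterate_sub_le hg hg0 hg' (one_le_volatility ha)
    (abs_volatility_sq_sub_le_sqDist ha) hσ ha0 (measurable_one.indicator hA)
    (abs_indicator_one_le A) _ _

theorem IsStationarySolution.abs_measureReal_inter_sub_mul_le
    (hy : IsStationarySolution P ε a y) (h : IIDWithLaw P ε (densityLaw g))
    (hg : Differentiable ℝ g) (hg0 : ∀ x, 0 ≤ g x) (hg' : Integrable fun x => deriv g x * x)
    (hν : Integrable (fun e => e ^ 2) (densityLaw g)) (ha : ∀ j, 0 ≤ a j)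
    (ha1 : (∑ j, a j) * ∫ e, e ^ 2 ∂(densityLaw g) < 1) {θ : ℝ} (hθ : 0 < θ)
    (hθ1 : θ ≤ 1) (haθ : (∑ j, a j) * ∫ e, e ^ 2 ∂(densityLaw g) ≤ θ ^ p)
    {A B : Set Ω} {n : ℕ} (hA : MeasurableSet[sigmaLag p y (n + p)] A)
    (hB : MeasurableSet[sigmaPast y] B) :
    |P.real (A ∩ B) - P.real A * P.real B| ≤
      covarianceConst p g (∫ e, e ^ 2 ∂(densityLaw g)) θ (∑ j, a j) * θ ^ n := by
  obtain ⟨x, hx, hyx⟩ := hy.exists_adapted_version h hν ha ha1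
  obtain ⟨D, hD, rfl⟩ := hA
  obtain ⟨B', hB', hBB'⟩ := exists_measurableSet_sigmaOn_ae_eq hx hyx hB
  have hlag : ∀ᵐ ω ∂P, ∀ t, lagVector p y t ω = lagVector p x t ω := by
    filter_upwards [ae_all_iff.2 hyx] with ω hω t
    exact funext fun j => hω _
  have hY (t : ℤ) : Measurable[sigmaOn ε (Set.Iic t)] (lagVector p x t) :=
    measurable_lagVector fun s hs => (hx s).mono (sigmaOn_mono ε (Set.Iic_subset_Iic.2 hs)) le_rfl
  have hrec : ∀ᵐ ω ∂P, ∀ t, lagVector p x (t + 1) ω =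
      volStep (volatility a) (lagVector p x t ω) (ε (t + 1) ω) := by
    filter_upwards [hlag, hy.ae_lagVector_succ] with ω hω hstep t
    rw [← hω, ← hω, hstep]
  have hmoment (j : Fin p) := hy.integral_sq_lagVector_le h hν ha ha1 0 j
  have hsq (j : Fin p) : (fun ω => lagVector p y 0 ω j ^ 2) =ᵐ[P]
      fun ω => lagVector p x 0 ω j ^ 2 := hlag.mono fun ω hω => by simp only [hω]
  simp only [integrable_congr (hsq _), integral_congr_ae (hsq _)] at hmoment
  have hpre : lagVector p y (n + p) ⁻¹' D =ᵐ[P] lagVector p x (n + p) ⁻¹' D :=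
    hlag.mono fun ω hω => congrArg (· ∈ D) (hω _)
  rw [measureReal_congr (hpre.inter hBB'), measureReal_congr hpre, measureReal_congr hBB']
  refine (h.abs_measureReal_inter_sub_mul_le_pow hg hg0 hg' hν ha hθ hθ1 haθ hY hrec hmoment hD hB'
    n).trans_eq ?_
  unfold covarianceConst
  ring

end CovarianceDecay

theorem sum_le_of_mem_thetaDelta {p : ℕ} {β δ : ℝ} {a b : Fin p → ℝ} (ha : a ∈ ThetaDelta p β b δ) :
    ∑ j, a j ≤ l1Norm b + δ :=
  calc ∑ j, a j ≤ ∑ j, (|b j| + |a j - b j|) :=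
        Finset.sum_le_sum fun j _ => by linarith [le_abs_self (a j - b j), le_abs_self (b j)]
    _ = l1Norm b + l1Norm fun j => a j - b j := Finset.sum_add_distrib
    _ ≤ l1Norm b + δ := add_le_add le_rfl ha.1

end ARCH

end

theorem mainTheorem1_general {Ω : Type*} [MeasurableSpace Ω] (P : Measure Ω)
    [IsProbabilityMeasure P] (p : ℕ) (g : ℝ → ℝ) (ε : ℤ → Ω → ℝ)
    (hε : ARCH.IIDWithDensity P ε g) (hsq : Integrable (fun ω => ε 1 ω ^ 2) P)
    (hg : Differentiable ℝ g) (hg0 : ∀ x, 0 ≤ g x) (hg' : Integrable fun x => deriv g x * x)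
    (S : ℝ) (hS : (∫ ω, ε 1 ω ^ 2 ∂P) * S < 1) :
    ∃ C γ : ℝ, 0 < γ ∧
      ∀ a : Fin p → ℝ, (∀ j, 0 ≤ a j) → ∑ j, a j ≤ S →
        ∀ y : ℤ → Ω → ℝ, ARCH.IsStationarySolution P ε a y → ∀ t : ℤ,
          ARCH.strongMixingCoeff P (ARCH.sigmaLag p y (t - 1)) (ARCH.sigmaPast y)
            ≤ C * Real.exp (-γ * t) := by
  obtain ⟨hν, hm⟩ := hε.integral_sq_densityLaw hsq
  set m := ∫ e, e ^ 2 ∂(ARCH.densityLaw g)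
  have hm0 : 0 ≤ m := integral_nonneg fun e => sq_nonneg e
  rw [← hm, mul_comm] at hS
  obtain ⟨θ, hθ, hθ1, hSθ⟩ := ARCH.exists_pow_ge_of_lt_one hS p
  refine ⟨(ARCH.covarianceConst p g m θ S + 1) * θ⁻¹ ^ (p + 1), -Real.log θ,
    neg_pos.2 (Real.log_neg hθ hθ1), fun a ha haS y hy t => ?_⟩
  have ham : (∑ j, a j) * m ≤ S * m := mul_le_mul_of_nonneg_right haS hm0
  have hconst := ARCH.covarianceConst_le_covarianceConst (p := p) (g := g) hm0 hθ.le
    (Finset.sum_nonneg fun j _ => ha j) haS hS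
  rw [neg_neg]
  refine ARCH.strongMixingCoeff_le_mul_exp (𝒜 := fun t => ARCH.sigmaLag p y (t - 1)) hθ hθ1.le
    (fun n A B hA hB => ?_) t
  rw [Nat.cast_succ, ← add_assoc, add_sub_cancel_right] at hA
  exact (hy.abs_measureReal_inter_sub_mul_le hε.iidWithLaw hg hg0 hg' hν ha (ham.trans_lt hS) hθ
    hθ1.le (ham.trans hSθ) hA hB).trans
      (mul_le_mul_of_nonneg_right hconst (pow_nonneg hθ.le n))

theorem mainTheorem1 {Ω : Type*} [MeasurableSpace Ω] (P : Measure Ω) [IsProbabilityMeasure P]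
    (p : ℕ) (g : ℝ → ℝ) (ε : ℤ → Ω → ℝ)
    (hε : ARCH.IIDWithDensity P ε g)
    (hmean : ∫ ω, ε 1 ω ∂P = 0)
    (hsq : Integrable (fun ω => ε 1 ω ^ 2) P)
    (hg : ARCH.RegularDensity g)
    (β : ℝ) (hβ : 0 < β) (hβε : β ≤ ∫ ω, ε 1 ω ^ 2 ∂P)
    (b : Fin p → ℝ) (hb : b ∈ ARCH.Theta p β)
    (δ : ℝ) (hδ : 0 < δ)
    (hstat : (∫ ω, ε 1 ω ^ 2 ∂P) * (ARCH.l1Norm b + δ) < 1) :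
    ∃ C γ : ℝ, 0 < γ ∧
      ∀ a ∈ ARCH.ThetaDelta p β b δ, ∀ y : ℤ → Ω → ℝ, ARCH.IsStationarySolution P ε a y →
        ∀ t : ℤ,
          ARCH.strongMixingCoeff P (ARCH.sigmaLag p y (t - 1)) (ARCH.sigmaPast y)
            ≤ C * Real.exp (-γ * t) := by
  obtain ⟨C, γ, hγ, hC⟩ := mainTheorem1_general P p g ε hε hsq hg.differentiable
    (fun x => (hg.pos x).le) hg.integrable_deriv _ hstat
  exact ⟨C, γ, hγ, fun a ha => hC a ha.2.1 (ARCH.sum_le_of_mem_thetaDelta ha)⟩
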